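/- All graphs are finite, simple and undirected. The stability number $\alpha(G)$ of a graph $G$ is the maximum size of a stable (independent) set of $G$, and the Fibonacci index $F(G)$ is the number of all stable sets of $G$, including the empty set. For integers $1\le\alpha\le n$, let $T(n,\alpha)$ be the disjoint union of $\alpha$ cliques with $n$ vertices in total whose orders differ pairwise by at most one. For $1\le\alpha\le n-1$, and for $n=\alpha=1$, the Turán-connected graph $T_c(n,\alpha)$ is obtained from $T(n,\alpha)$ by choosing a vertex $v$ of a clique of order $\lceil n/\alpha\rceil$ and adding $\alpha-1$ edges, each joining $v$ to one vertex of a different one of the remaining $\alpha-1$ cliques; it is unique up to isomorphism. Put $f_{\mathsf{TC}}(n,\alpha)=F(T_c(n,\alpha))$. **Theorem.** Let $G$ be a connected graph of order $n$ with stability number $\alpha$. Then $$F(G)\le f_{\mathsf{TC}}(n,\alpha).$$ If $(n,\alpha)\ne(5,2)$, equality holds if and only if $G\simeq T_c(n,\alpha)$. If $(n,\alpha)=(5,2)$, equality holds if and only if $G\simeq T_c(5,2)$ or $G\simeq C_5$, where $C_5$ is the cycle on five vertices. -/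

import Mathlib

/-- The Fibonacci index `F(G)` of a finite graph: the number of all its stable (independent) sets,
including the empty set. -/
noncomputable def fibonacciIndex {V : Type*} (G : SimpleGraph V) : ℕ :=
  Nat.card {s : Finset V // G.IsIndepSet (s : Set V)}

/-- The Turán graph `T(n, α)`, as a union of `α` disjoint balanced cliques: the cliques are the
residue classes mod `α` on the vertex set `{0, …, n - 1}`, so it is the complement of Mathlib's
complete multipartite Turán graph. -/
def cliqueTuranGraph (n α : ℕ) : SimpleGraph (Fin n) :=
  (SimpleGraph.turanGraph n α)ᶜ

/-- The Turán-connected graph `T_c(n, α)`, for `1 ≤ α ≤ n - 1` or `n = α = 1`: the graph `T(n, α)` together with the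
`α - 1` edges joining the vertex `0`, whose clique has the largest size `⌈n / α⌉`, to the vertices
`1, …, α - 1`, one in each of the other cliques. -/
def turanConnectedGraph (n α : ℕ) : SimpleGraph (Fin n) :=
  cliqueTuranGraph n α ⊔
    SimpleGraph.fromRel (fun i j : Fin n => (i : ℕ) = 0 ∧ 1 ≤ (j : ℕ) ∧ (j : ℕ) < α)

/-- `f_TC(n, α)`, the Fibonacci index of the Turán-connected graph `T_c(n, α)`. -/
noncomputable def fTC (n α : ℕ) : ℕ :=
  fibonacciIndex (turanConnectedGraph n α)

/-!
Write `F(S)` for the number of stable sets inside a set `S` of vertices. Everything rests on the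
recursion `F(S) = F(S \ v) + F(S \ N[v])` (`SimpleGraph.numStable_eq`).

*Arbitrary graphs.* A graph of order `n` and stability number `a` has a vertex of degree at least
`(n - 1) / a`. Deleting it and inducting gives the Turán bound `F ≤ turanCount n a`, with equality
only for balanced unions of cliques (`StableLE.numStable_le`, `StableLE.exists_isCliqueUnion`).

*Connected graphs.* With `T_c(n, a)` split at its centre, its Fibonacci index is
`turanConnCount n a = turanCount (n - 1) a + centerCount (n - 1) a`. The bound is proved by
induction on the order and on the set of edges (`ConnectedOn.turanConnBound`), in three cases.

* Some edge is neither a bridge nor critical, where an edge is critical if its deletion increases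
  the stability number. Deleting it keeps all hypotheses and creates a new stable set.
* Some bridge `xy` is not critical. Then order and stability number add up over the two sides. The
  count is an increasing function of the counts for the two sides and for the two sides without `x`
  and `y`, which are bounded by induction and by the Turán bound. The resulting estimate is the
  index of two Turán-connected graphs with adjacent centres. Moving all connecting edges to one of
  the centres, choosing a largest clique as central clique and balancing the cliques can only
  increase it (`turanConnCount_join_le`).
* All edges are critical. Then there is no cut vertex (`ConnectedOn.erase`), and in a connected
  graph the maximum degree `D` satisfies `n ≤ a D + 1` (`ConnectedOn.card_le`). Delete a vertex `v`
  of degree `D`: induction bounds `F(S \ v)` by `turanConnCount`, the Turán bound applies to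
  `F(S \ N[v])`, and the sum is small enough (`turanConnCount_add_le`).

*Equality.* In the second case equality forces `F(S \ x)`, or `F(S \ y)`, to attain the Turán bound;
in the third case it forces `a = 1`, or `a = 2` and a five-cycle
(`isCycleFive_of_isTuranConn_erase`). If `F(S \ v)` attains the Turán bound, then `S \ v` is a
balanced union of cliques, and connectedness together with the known number of stable sets through
`v` leaves only a Turán-connected graph with centre `v` (`ConnectedOn.exists_isTuranConn`). Such a
graph is unique up to isomorphism (`IsTuranConn.nonempty_iso`).
-/

open Finset

/-! ### Integer inequalities -/

/-- Tangent-line inequality `x ≤ q (1 + 1/q) ^ (x - q)`, cleared of denominators. It is an equality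
at the two integers `x = q` and `x = q + 1`. -/
theorem mul_pow_le_of_tangent (q x : ℕ) :
    x * (q ^ x * (q + 1) ^ q) ≤ q ^ (q + 1) * (q + 1) ^ x := by
  rcases le_total q x with h | h
  · obtain ⟨k, rfl⟩ := Nat.exists_eq_add_of_le h
    have key : (q + k) * q ^ k ≤ q * (q + 1) ^ k := by
      clear h
      induction k with
      | zero => simp
      | succ k ih =>
        calc (q + (k + 1)) * q ^ (k + 1) = ((q + k + 1) * q) * q ^ k := by ring
          _ ≤ ((q + k) * (q + 1)) * q ^ k := Nat.mul_le_mul_right _ (by nlinarith)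
          _ = ((q + k) * q ^ k) * (q + 1) := by ring
          _ ≤ (q * (q + 1) ^ k) * (q + 1) := Nat.mul_le_mul_right _ ih
          _ = _ := by ring
    calc (q + k) * (q ^ (q + k) * (q + 1) ^ q)
        = ((q + k) * q ^ k) * (q ^ q * (q + 1) ^ q) := by ring
      _ ≤ (q * (q + 1) ^ k) * (q ^ q * (q + 1) ^ q) := Nat.mul_le_mul_right _ key
      _ = _ := by ring
  · have key : ∀ k x, x + k = q → x * (q + 1) ^ k ≤ q ^ (k + 1) := by
      intro k
      induction k with
      | zero => intro x hx; simp; omega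
      | succ k ih =>
        intro x hx
        calc x * (q + 1) ^ (k + 1) = (x * (q + 1)) * (q + 1) ^ k := by ring
          _ ≤ ((x + 1) * q) * (q + 1) ^ k := Nat.mul_le_mul_right _ (by nlinarith)
          _ = ((x + 1) * (q + 1) ^ k) * q := by ring
          _ ≤ q ^ (k + 1) * q := Nat.mul_le_mul_right _ (ih _ (by omega))
          _ = _ := by ring
    obtain ⟨k, hk⟩ := Nat.exists_eq_add_of_le h
    have := key k x hk.symm
    calc x * (q ^ x * (q + 1) ^ q) = (x * (q + 1) ^ k) * (q ^ x * (q + 1) ^ x) := by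
          nth_rewrite 3 [hk]; ring
      _ ≤ q ^ (k + 1) * (q ^ x * (q + 1) ^ x) := Nat.mul_le_mul_right _ this
      _ = q ^ (x + k + 1) * (q + 1) ^ x := by ring
      _ = _ := by rw [← hk]

/-- The integer form of the inequality of arithmetic and geometric means: for a given sum, the
product is largest for a balanced multiset. -/
theorem Multiset.prod_le_balanced (s : Multiset ℕ) {q b r : ℕ} (hq : 0 < q) (hb : s.card = b)
    (hr : r ≤ b) (hs : s.sum ≤ q * b + r) : s.prod ≤ (q + 1) ^ r * q ^ (b - r) := by
  have h1 : s.prod * (q ^ s.sum * (q + 1) ^ (q * s.card)) ≤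
      q ^ ((q + 1) * s.card) * (q + 1) ^ s.sum := by
    clear hb hs
    induction s using Multiset.induction with
    | empty => simp
    | cons x s ih =>
      simp only [Multiset.prod_cons, Multiset.sum_cons, Multiset.card_cons]
      calc x * s.prod * (q ^ (x + s.sum) * (q + 1) ^ (q * (s.card + 1)))
          = (x * (q ^ x * (q + 1) ^ q)) * (s.prod * (q ^ s.sum * (q + 1) ^ (q * s.card))) := by
            ring
        _ ≤ (q ^ (q + 1) * (q + 1) ^ x) * (q ^ ((q + 1) * s.card) * (q + 1) ^ s.sum) :=
            Nat.mul_le_mul (mul_pow_le_of_tangent q x) ih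
        _ = _ := by ring
  rw [hb] at h1
  obtain ⟨t, ht⟩ := Nat.exists_eq_add_of_le hs
  have h2 : s.prod * (q ^ (q * b + r) * (q + 1) ^ (q * b)) ≤
      q ^ ((q + 1) * b) * (q + 1) ^ (q * b + r) := by
    rw [ht]
    calc s.prod * (q ^ (s.sum + t) * (q + 1) ^ (q * b))
        = (s.prod * (q ^ s.sum * (q + 1) ^ (q * b))) * q ^ t := by ring
      _ ≤ (q ^ ((q + 1) * b) * (q + 1) ^ s.sum) * (q + 1) ^ t :=
          Nat.mul_le_mul h1 (Nat.pow_le_pow_left (by omega) _)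
      _ = _ := by ring
  obtain ⟨d, rfl⟩ := Nat.exists_eq_add_of_le hr
  rw [Nat.add_sub_cancel_left]
  refine Nat.le_of_mul_le_mul_right (c := q ^ (q * (r + d) + r) * (q + 1) ^ (q * (r + d))) ?_
    (by positivity)
  refine h2.trans (le_of_eq ?_)
  ring

/-- The values of a balanced function on `Fin a` with sum `n` are `n / a` and `n / a + 1`. -/
theorem div_le_of_balanced {a n : ℕ} {f : Fin a → ℕ} (hf : ∀ i j, f i ≤ f j + 1)
    (hs : ∑ i, f i = n) (i : Fin a) : n / a ≤ f i ∧ f i ≤ n / a + 1 := by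
  have ha : 0 < a := i.pos
  constructor
  · by_contra! hlt
    have h1 : ∑ j, f j < ∑ _j : Fin a, n / a :=
      sum_lt_sum (fun j _ => by have := hf j i; omega) ⟨i, mem_univ _, hlt⟩
    rw [hs, sum_const, card_univ, Fintype.card_fin, smul_eq_mul] at h1
    have := Nat.mul_div_le n a
    omega
  · by_contra! hlt
    have h1 : ∑ _j : Fin a, (n / a + 1) ≤ ∑ j, f j :=
      sum_le_sum (fun j _ => by have := hf i j; omega)
    rw [hs, sum_const, card_univ, Fintype.card_fin, smul_eq_mul] at h1
    have := Nat.lt_mul_div_succ n ha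
    omega

/-- The product of a family with two consecutive values and given sum. -/
theorem prod_of_two_values {ι : Type*} (s : Finset ι) (f : ι → ℕ) {q r : ℕ}
    (hf : ∀ i ∈ s, f i = q ∨ f i = q + 1) (hs : ∑ i ∈ s, f i = q * #s + r) (k : ℕ) :
    r ≤ #s ∧ ∏ i ∈ s, (f i + k) = (q + 1 + k) ^ r * (q + k) ^ (#s - r) := by
  classical
  induction s using Finset.induction generalizing r with
  | empty =>
    obtain rfl : r = 0 := by simpa using hs.symm
    simp
  | insert i s hi ih =>
    rw [sum_insert hi, card_insert_of_notMem hi] at hs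
    rw [prod_insert hi, card_insert_of_notMem hi]
    have hf' : ∀ j ∈ s, f j = q ∨ f j = q + 1 := fun j hj => hf j (mem_insert_of_mem hj)
    rcases hf i (mem_insert_self _ _) with e | e
    · obtain ⟨h1, h2⟩ := ih hf' (r := r) (by rw [e] at hs; nlinarith)
      refine ⟨by omega, ?_⟩
      rw [h2, e, Nat.sub_add_comm h1]; ring
    · have hge : q * #s ≤ ∑ j ∈ s, f j := by
        rw [mul_comm, ← smul_eq_mul]
        exact card_nsmul_le_sum _ _ _ fun j hj => by rcases hf' j hj with e | e <;> omega
      obtain ⟨r', rfl⟩ : ∃ r', r = r' + 1 := ⟨r - 1, by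
        have : 0 < r := by nlinarith
        omega⟩
      obtain ⟨h1, h2⟩ := ih hf' (r := r') (by rw [e] at hs; nlinarith)
      refine ⟨by omega, ?_⟩
      rw [h2, e]
      have : #s + 1 - (r' + 1) = #s - r' := by omega
      rw [this]; ring

/-- The number of stable sets of a disjoint union of cliques `C₀, C₁, …` together with one edge
from a fixed vertex of `C₀` to each other clique, where `C₀` has order `c` and the orders of the
other cliques form the multiset `s`. -/
def starCount (c : ℕ) (s : Multiset ℕ) : ℕ := c * (s.map (· + 1)).prod + s.prod

theorem Multiset.prod_le_prod_map_succ (s : Multiset ℕ) : s.prod ≤ (s.map (· + 1)).prod := by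
  induction s using Multiset.induction with
  | empty => simp
  | cons x s ih => simp only [Multiset.map_cons, Multiset.prod_cons]; gcongr; omega

theorem Multiset.prod_map_succ_pos (s : Multiset ℕ) : 0 < (s.map (· + 1)).prod := by
  induction s using Multiset.induction with
  | empty => simp
  | cons x s ih => simp only [Multiset.map_cons, Multiset.prod_cons]; positivity

theorem Multiset.prod_lt_prod_map_succ {s : Multiset ℕ} (hs : s ≠ 0) :
    s.prod < (s.map (· + 1)).prod := by
  obtain ⟨x, t, rfl⟩ : ∃ x t, s = x ::ₘ t := by
    obtain ⟨x, hx⟩ := Multiset.exists_mem_of_ne_zero hs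
    exact ⟨x, _, (Multiset.cons_erase hx).symm⟩
  have := Multiset.prod_le_prod_map_succ t
  have := Multiset.prod_map_succ_pos t
  simp only [Multiset.map_cons, Multiset.prod_cons]
  nlinarith

theorem starCount_swap_add (c k : ℕ) (s : Multiset ℕ) :
    starCount c ((c + k) ::ₘ s) + k * (s.map (· + 1)).prod =
      starCount (c + k) (c ::ₘ s) + k * s.prod := by
  simp only [starCount, Multiset.map_cons, Multiset.prod_cons]
  ring

/-- Making the larger of two cliques the central one does not decrease the count. -/
theorem starCount_swap_le {c d : ℕ} (h : c ≤ d) (s : Multiset ℕ) :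
    starCount c (d ::ₘ s) ≤ starCount d (c ::ₘ s) := by
  obtain ⟨k, rfl⟩ := Nat.exists_eq_add_of_le h
  have := starCount_swap_add c k s
  have := Nat.mul_le_mul_left k s.prod_le_prod_map_succ
  omega

theorem starCount_swap_lt {c d : ℕ} (h : c < d) {s : Multiset ℕ} (hs : s ≠ 0) :
    starCount c (d ::ₘ s) < starCount d (c ::ₘ s) := by
  obtain ⟨k, rfl⟩ := Nat.exists_eq_add_of_le h.le
  have := starCount_swap_add c k s
  have := Nat.mul_lt_mul_of_pos_left (Multiset.prod_lt_prod_map_succ hs) (show 0 < k by omega)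
  omega

/-- If the central clique is at least as large as a balanced partition requires, both summands of
`starCount` are at most their balanced values. -/
theorem starCount_le_of_large {q b r c : ℕ} {s : Multiset ℕ} (hq : 0 < q) (hr : r ≤ b)
    (hs : s.card = b) (hsum : c + s.sum = q * (b + 1) + r + 1) (hc : q + 1 ≤ c) :
    c * (s.map (· + 1)).prod ≤ (q + 2) ^ r * (q + 1) ^ (b + 1 - r) ∧
      s.prod ≤ (q + 1) ^ r * q ^ (b - r) := by
  constructor
  · have := Multiset.prod_le_balanced (c ::ₘ s.map (· + 1)) (q := q + 1) (b := b + 1) (r := r)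
      (by omega) (by simp [hs]) (by omega) (by
        simp only [Multiset.sum_cons, Multiset.sum_map_add, Multiset.map_id', Multiset.map_const',
          Multiset.sum_replicate, hs, smul_eq_mul]
        nlinarith)
    simpa using this
  · exact Multiset.prod_le_balanced s hq hs hr (by nlinarith)

theorem exists_le_of_mul_lt_sum {s : Multiset ℕ} {k : ℕ} (h : k * s.card < s.sum) :
    ∃ d ∈ s, k + 1 ≤ d := by
  by_contra! hlt
  have := Multiset.sum_le_card_nsmul s k (fun x hx => by have := hlt x hx; omega)
  rw [smul_eq_mul, mul_comm] at this
  omega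

/-- Among all sizes of the cliques, `starCount` is largest for a balanced partition with a largest
clique at the centre. -/
theorem starCount_le {q b r c : ℕ} {s : Multiset ℕ} (hq : 0 < q) (hr : r ≤ b)
    (hs : s.card = b) (hsum : c + s.sum = q * (b + 1) + r + 1) :
    starCount c s ≤ (q + 2) ^ r * (q + 1) ^ (b + 1 - r) + (q + 1) ^ r * q ^ (b - r) ∧
    (starCount c s = (q + 2) ^ r * (q + 1) ^ (b + 1 - r) + (q + 1) ^ r * q ^ (b - r) →
      c * (s.map (· + 1)).prod = (q + 2) ^ r * (q + 1) ^ (b + 1 - r) ∨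
      ∃ d, s = {d} ∧ d * (c + 1) = (q + 2) ^ r * (q + 1) ^ (b + 1 - r)) := by
  rcases le_or_gt (q + 1) c with hc | hc
  · obtain ⟨h1, h2⟩ := starCount_le_of_large hq hr hs hsum hc
    unfold starCount
    exact ⟨by omega, fun h => Or.inl (by omega)⟩
  · obtain ⟨d, hd, hqd⟩ : ∃ d ∈ s, q + 1 ≤ d := exists_le_of_mul_lt_sum (by rw [hs]; nlinarith)
    obtain ⟨t, rfl⟩ : ∃ t, s = d ::ₘ t := ⟨_, (Multiset.cons_erase hd).symm⟩
    obtain ⟨h1, h2⟩ := starCount_le_of_large (c := d) (s := c ::ₘ t) hq hr (by simpa using hs)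
      (by simp only [Multiset.sum_cons] at hsum ⊢; omega) hqd
    have h3 := starCount_swap_le (c := c) (d := d) (by omega) t
    have h4 : starCount d (c ::ₘ t) = d * ((c ::ₘ t).map (· + 1)).prod + (c ::ₘ t).prod := rfl
    refine ⟨by omega, fun h => Or.inr ⟨d, ?_, ?_⟩⟩
    · by_cases ht : t = 0
      · simp [ht]
      · have := starCount_swap_lt (c := c) (d := d) (by omega) ht
        omega
    · by_cases ht : t = 0
      · subst ht
        simp only [Multiset.map_cons, Multiset.map_zero, Multiset.prod_cons, Multiset.prod_zero,
          mul_one] at h1 h2 h4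
        omega
      · have := starCount_swap_lt (c := c) (d := d) (by omega) ht
        omega

/-- Joining the centres of two stars of cliques, neither of which is a single clique, gives strictly
fewer stable sets than the balanced star. The last hypothesis says that moving the edges at the
second centre to the first one does not decrease the count. -/
theorem starCount_add_lt_aux {q b r c d : ℕ} {m l : Multiset ℕ} (hq : 0 < q) (hr : r ≤ b)
    (hm : m ≠ 0) (hl : l ≠ 0) (hc : 0 < c) (hcard : m.card + l.card + 1 = b)
    (hsum : c + m.sum + (d + l.sum) = q * (b + 1) + r + 1)
    (h : d * m.prod ≤ c * (m.map (· + 1)).prod) :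
    c * (m.map (· + 1)).prod * (d * (l.map (· + 1)).prod + l.prod) +
        m.prod * (d * (l.map (· + 1)).prod) <
      (q + 2) ^ r * (q + 1) ^ (b + 1 - r) + (q + 1) ^ r * q ^ (b - r) := by
  have h1 := (starCount_le (c := c) (s := d ::ₘ (m + l)) hq hr (by simp; omega)
    (by simp only [Multiset.sum_cons, Multiset.sum_add]; omega)).1
  have h2 := (starCount_le (c := d) (s := c ::ₘ (m + l)) hq hr (by simp; omega)
    (by simp only [Multiset.sum_cons, Multiset.sum_add]; omega)).1
  have hL := Multiset.prod_lt_prod_map_succ hl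
  have hM := Multiset.prod_lt_prod_map_succ hm
  have hml : m + l ≠ 0 := by simp [hm]
  have hs : starCount c (d ::ₘ (m + l)) = c * (m.map (· + 1)).prod * ((d + 1) *
      (l.map (· + 1)).prod) + d * m.prod * l.prod := by
    simp only [starCount, Multiset.map_cons, Multiset.prod_cons, Multiset.map_add,
      Multiset.prod_add]
    ring
  -- Moving the edges at the second centre to the first one changes the count by
  -- `(∏ (l + 1) - ∏ l) * (c ∏ (m + 1) - d ∏ m)`.
  obtain ⟨x, hx⟩ := Nat.exists_eq_add_of_lt hL
  obtain ⟨y, hy⟩ := Nat.exists_eq_add_of_le h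
  have hmove : c * (m.map (· + 1)).prod * (d * (l.map (· + 1)).prod + l.prod) +
        m.prod * (d * (l.map (· + 1)).prod) + (x + 1) * y = starCount c (d ::ₘ (m + l)) := by
    rw [hs, hy, hx]; ring
  -- If this change vanishes, then `c < d`, and moving the centre to the clique of order `d` gives a
  -- strict increase.
  rcases Nat.eq_zero_or_pos y with hy0 | hy0
  · have hcd : c < d := by
      by_contra! hdc
      have h3 : d * m.prod ≤ c * m.prod := Nat.mul_le_mul_right _ hdc
      have h4 := Nat.mul_lt_mul_of_pos_left hM hc
      omega
    have h3 := starCount_swap_lt hcd hml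
    omega
  · have : 0 < (x + 1) * y := by positivity
    omega

/-- Two star-shaped graphs of cliques joined by an edge between their centres have at most as many
stable sets as the balanced star with the same order and number of cliques. In the case of equality
one of the two stars is a single clique, so that the whole graph is itself a star. -/
theorem starCount_join_le {q b r c d : ℕ} {m l : Multiset ℕ} (hq : 0 < q) (hr : r ≤ b)
    (hc : 0 < c) (hd : 0 < d) (hcard : m.card + l.card + 1 = b)
    (hsum : c + m.sum + (d + l.sum) = q * (b + 1) + r + 1) :
    c * (m.map (· + 1)).prod * starCount d l + m.prod * (d * (l.map (· + 1)).prod) ≤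
      (q + 2) ^ r * (q + 1) ^ (b + 1 - r) + (q + 1) ^ r * q ^ (b - r) ∧
    (c * (m.map (· + 1)).prod * starCount d l + m.prod * (d * (l.map (· + 1)).prod) =
      (q + 2) ^ r * (q + 1) ^ (b + 1 - r) + (q + 1) ^ r * q ^ (b - r) →
      c * (m.map (· + 1)).prod * starCount d l = (q + 2) ^ r * (q + 1) ^ (b + 1 - r) ∨
      d * (l.map (· + 1)).prod * starCount c m = (q + 2) ^ r * (q + 1) ^ (b + 1 - r)) := by
  have hsymm : c * (m.map (· + 1)).prod * starCount d l + m.prod * (d * (l.map (· + 1)).prod) =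
      d * (l.map (· + 1)).prod * starCount c m + l.prod * (c * (m.map (· + 1)).prod) := by
    unfold starCount; ring
  by_cases hl : l = 0
  · subst hl
    have h := starCount_le (c := c) (s := d ::ₘ m) hq hr (by simpa using hcard)
      (by simp only [Multiset.sum_cons, Multiset.sum_zero] at hsum ⊢; omega)
    have e : c * (m.map (· + 1)).prod * starCount d 0 +
        m.prod * (d * ((0 : Multiset ℕ).map (· + 1)).prod) = starCount c (d ::ₘ m) := by
      simp [starCount]; ring
    rw [e]
    refine ⟨h.1, fun h' => (h.2 h').imp (fun h3 => ?_) ?_⟩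
    · rw [← h3]; simp [starCount]; ring
    · rintro ⟨x, hx, h3⟩
      have hm : m = 0 := by
        have := congrArg Multiset.card hx
        simpa using this
      subst hm
      obtain rfl : d = x := by simpa using hx
      rw [← h3]; simp [starCount]
  · by_cases hm : m = 0
    · subst hm
      have h := starCount_le (c := d) (s := c ::ₘ l) hq hr (by simpa using hcard)
        (by simp only [Multiset.sum_cons, Multiset.sum_zero] at hsum ⊢; omega)
      have e : c * ((0 : Multiset ℕ).map (· + 1)).prod * starCount d l +
          (0 : Multiset ℕ).prod * (d * (l.map (· + 1)).prod) = starCount d (c ::ₘ l) := by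
        simp [starCount]; ring
      rw [e]
      refine ⟨h.1, fun h' => Or.inr ?_⟩
      rcases h.2 h' with h3 | ⟨x, hx, h3⟩
      · rw [← h3]; simp [starCount]; ring
      · refine absurd ?_ hl
        have := congrArg Multiset.card hx
        simpa using this
    · suffices h : c * (m.map (· + 1)).prod * starCount d l +
          m.prod * (d * (l.map (· + 1)).prod) <
          (q + 2) ^ r * (q + 1) ^ (b + 1 - r) + (q + 1) ^ r * q ^ (b - r) from
        ⟨h.le, fun h' => absurd h' h.ne⟩
      rcases le_or_gt (d * m.prod) (c * (m.map (· + 1)).prod) with h | h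
      · exact starCount_add_lt_aux hq hr hm hl hc hcard hsum h
      · have hL := Multiset.prod_lt_prod_map_succ hl
        have hM := Multiset.prod_lt_prod_map_succ hm
        rw [hsymm]
        refine starCount_add_lt_aux hq hr hl hm hd (by omega) (by omega) ?_
        -- Not both shifts can decrease the count, as `∏ m * ∏ l ≤ ∏ (m + 1) * ∏ (l + 1)`.
        by_contra! h'
        have h1 : c * d * (m.prod * l.prod) ≤
            c * d * ((m.map (· + 1)).prod * (l.map (· + 1)).prod) :=
          Nat.mul_le_mul_left _ (Nat.mul_le_mul hM.le hL.le)
        have h2 := Nat.mul_lt_mul'' h h'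
        nlinarith

/-! ### The two extremal functions -/

/-- The number of stable sets of the Turán graph `T(n, a)`: with `n = q a + r`, it has `r` cliques
of order `q + 1` and `a - r` cliques of order `q`. -/
def turanCount (n a : ℕ) : ℕ := (n / a + 2) ^ (n % a) * (n / a + 1) ^ (a - n % a)

/-- The number of stable sets of `T_c(m + 1, a)` that contain the central vertex: with
`m = q a + r`, the cliques not containing the centre contribute `r` factors `q + 1` and
`a - 1 - r` factors `q`. -/
def centerCount (m a : ℕ) : ℕ := (m / a + 1) ^ (m % a) * (m / a) ^ (a - 1 - m % a)

/-- The number of stable sets of the Turán-connected graph `T_c(n, a)`. -/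
def turanConnCount (n a : ℕ) : ℕ := turanCount (n - 1) a + centerCount (n - 1) a

theorem turanCount_eq {q a r : ℕ} (hr : r ≤ a) :
    turanCount (q * a + r) a = (q + 2) ^ r * (q + 1) ^ (a - r) := by
  rcases hr.eq_or_lt with rfl | hr
  · rcases Nat.eq_zero_or_pos r with rfl | h0
    · simp [turanCount]
    · have h1 : (q * r + r) / r = q + 1 := by
        rw [← Nat.succ_mul]; exact Nat.mul_div_cancel _ h0
      have h2 : (q * r + r) % r = 0 := by simp
      simp [turanCount, h1, h2]
  · have h1 : (q * a + r) / a = q := by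
      rw [mul_comm, Nat.mul_add_div (by omega), Nat.div_eq_of_lt hr, add_zero]
    have h2 : (q * a + r) % a = r := by
      rw [mul_comm, Nat.mul_add_mod, Nat.mod_eq_of_lt hr]
    simp [turanCount, h1, h2]

theorem centerCount_eq {q a r : ℕ} (hr : r ≤ a) :
    centerCount (q * (a + 1) + r) (a + 1) = (q + 1) ^ r * q ^ (a - r) := by
  have h1 : (q * (a + 1) + r) / (a + 1) = q := by
    rw [mul_comm, Nat.mul_add_div (by omega), Nat.div_eq_of_lt (by omega), add_zero]
  have h2 : (q * (a + 1) + r) % (a + 1) = r := by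
    rw [mul_comm, Nat.mul_add_mod, Nat.mod_eq_of_lt (by omega)]
  simp [centerCount, h1, h2]

theorem exists_eq_mul_add (n a : ℕ) : ∃ q r, r ≤ a ∧ n = q * (a + 1) + r :=
  ⟨n / (a + 1), n % (a + 1), Nat.lt_succ_iff.mp (Nat.mod_lt _ (by omega)),
    (Nat.div_add_mod' n (a + 1)).symm⟩

/-- Deleting a vertex of a largest clique of the Turán graph. -/
theorem turanCount_succ_succ (n a : ℕ) :
    turanCount (n + 1) (a + 1) = turanCount n (a + 1) + turanCount (n - n / (a + 1)) a := by
  obtain ⟨q, r, hr, rfl⟩ := exists_eq_mul_add n a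
  have h1 : (q * (a + 1) + r) / (a + 1) = q := by
    rw [mul_comm, Nat.mul_add_div (by omega), Nat.div_eq_of_lt (by omega), add_zero]
  have h2 : q * (a + 1) + r - q = q * a + r := by rw [Nat.mul_succ]; omega
  rw [h1, h2, turanCount_eq hr, add_assoc, turanCount_eq (by omega), turanCount_eq (by omega)]
  obtain ⟨k, rfl⟩ := Nat.exists_eq_add_of_le hr
  have e1 : r + k + 1 - (r + 1) = k := by omega
  have e2 : r + k + 1 - r = k + 1 := by omega
  have e3 : r + k - r = k := by omega
  rw [e1, e2, e3]; ring

theorem turanCount_pos (n a : ℕ) : 0 < turanCount n a := by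
  unfold turanCount; positivity

theorem turanCount_strictMono (a : ℕ) : StrictMono fun n => turanCount n a := by
  refine strictMono_nat_of_lt_succ fun n => ?_
  cases a with
  | zero =>
    simp only [turanCount, Nat.div_zero, Nat.mod_zero]
    simp only [zero_add, Nat.one_pow, mul_one]
    exact Nat.pow_lt_pow_right (by omega) (by omega)
  | succ a =>
    have := turanCount_pos (n - n / (a + 1)) a
    simp only [turanCount_succ_succ n a]
    omega

theorem centerCount_succ (q : ℕ) {a r : ℕ} (hr : r < a) :
    q * centerCount (q * (a + 1) + r + 1) (a + 1) =
      (q + 1) * centerCount (q * (a + 1) + r) (a + 1) := by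
  rw [add_assoc, centerCount_eq (show r + 1 ≤ a from hr), centerCount_eq hr.le]
  obtain ⟨k, rfl⟩ := Nat.exists_eq_add_of_lt hr
  have e1 : r + k + 1 - (r + 1) = k := by omega
  have e2 : r + k + 1 - r = k + 1 := by omega
  rw [e1, e2]; ring

theorem centerCount_pos {m a : ℕ} (h : a ≤ m) : 0 < centerCount m (a + 1) := by
  obtain ⟨q, r, hr, rfl⟩ := exists_eq_mul_add m a
  rw [centerCount_eq hr]
  rcases Nat.eq_zero_or_pos q with rfl | hq
  · obtain rfl : r = a := by omega
    simp
  · positivity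

/-- Increasing the order increases the number of stable sets through the centre unless the new
vertex goes into the central clique. -/
theorem centerCount_le_succ (m a : ℕ) (h : a ≤ m) :
    centerCount m (a + 1) ≤ centerCount (m + 1) (a + 1) ∧
      (centerCount m (a + 1) = centerCount (m + 1) (a + 1) → a + 1 ∣ m + 1) := by
  obtain ⟨q, r, hr, rfl⟩ := exists_eq_mul_add m a
  rcases hr.eq_or_lt with rfl | hr
  · have e : q * (r + 1) + r + 1 = (q + 1) * (r + 1) + 0 := by ring
    rw [e, centerCount_eq le_rfl, centerCount_eq (by omega)]
    simp
  · have h1 : 0 < q := by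
      rcases Nat.eq_zero_or_pos q with rfl | h1
      · omega
      · exact h1
    have h2 := centerCount_succ q hr
    have h3 : 0 < centerCount (q * (a + 1) + r) (a + 1) := by
      rw [centerCount_eq hr.le]; positivity
    have : centerCount (q * (a + 1) + r) (a + 1) < centerCount (q * (a + 1) + r + 1) (a + 1) := by
      nlinarith
    exact ⟨this.le, fun h => absurd h this.ne⟩

/-- The parameters of `T_c(n, a + 1)` as a star of cliques. -/
theorem exists_starCount (n a : ℕ) (h : a ≤ n) : ∃ (c : ℕ) (m : Multiset ℕ),
    0 < c ∧ m.card = a ∧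
    c + m.sum = n + 1 ∧ c * (m.map (· + 1)).prod = turanCount n (a + 1) ∧
    m.prod = centerCount n (a + 1) := by
  obtain ⟨q, r, hr, rfl⟩ := exists_eq_mul_add n a
  refine ⟨q + 1, Multiset.replicate r (q + 1) + Multiset.replicate (a - r) q, by omega, ?_, ?_,
    ?_, ?_⟩
  · simp; omega
  · simp only [Multiset.sum_add, Multiset.sum_replicate, smul_eq_mul]
    obtain ⟨k, rfl⟩ := Nat.exists_eq_add_of_le hr
    rw [Nat.add_sub_cancel_left]; ring
  · rw [turanCount_eq (by omega)]
    obtain ⟨k, rfl⟩ := Nat.exists_eq_add_of_le hr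
    have e2 : r + k + 1 - r = k + 1 := by omega
    simp [e2]; ring
  · rw [centerCount_eq hr]; simp

/-- Joining the centres of two Turán-connected graphs by an edge. -/
theorem turanConnCount_join_le {n₁ n₂ a b : ℕ} (h₁ : a ≤ n₁) (h₂ : b ≤ n₂)
    (h : a + b + 2 ≤ n₁ + n₂ + 1) :
    turanCount n₁ (a + 1) * turanConnCount (n₂ + 1) (b + 1) +
        centerCount n₁ (a + 1) * turanCount n₂ (b + 1) ≤
      turanConnCount (n₁ + n₂ + 2) (a + b + 2) ∧
    (turanCount n₁ (a + 1) * turanConnCount (n₂ + 1) (b + 1) +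
        centerCount n₁ (a + 1) * turanCount n₂ (b + 1) =
      turanConnCount (n₁ + n₂ + 2) (a + b + 2) →
      turanCount n₁ (a + 1) * turanConnCount (n₂ + 1) (b + 1) =
        turanCount (n₁ + n₂ + 1) (a + b + 2) ∨
      turanCount n₂ (b + 1) * turanConnCount (n₁ + 1) (a + 1) =
        turanCount (n₁ + n₂ + 1) (a + b + 2)) := by
  obtain ⟨c, m, hc, hm, hcm, hT, hB⟩ := exists_starCount n₁ a h₁
  obtain ⟨d, l, hd, hl, hdl, hT', hB'⟩ := exists_starCount n₂ b h₂
  obtain ⟨q, r, hr, e⟩ := exists_eq_mul_add (n₁ + n₂ + 1) (a + b + 1)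
  have hq : 0 < q := by
    rcases Nat.eq_zero_or_pos q with rfl | h1
    · omega
    · exact h1
  have := starCount_join_le hq hr hc hd (m := m) (l := l) (by omega) (by omega)
  have e1 : turanConnCount (n₁ + n₂ + 2) (a + b + 2) =
      (q + 2) ^ r * (q + 1) ^ (a + b + 1 + 1 - r) + (q + 1) ^ r * q ^ (a + b + 1 - r) := by
    simp only [turanConnCount]
    have : n₁ + n₂ + 2 - 1 = n₁ + n₂ + 1 := by omega
    rw [this, e, centerCount_eq hr, turanCount_eq (by omega)]
  have e2 : turanCount (n₁ + n₂ + 1) (a + b + 2) =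
      (q + 2) ^ r * (q + 1) ^ (a + b + 1 + 1 - r) := by
    rw [e, turanCount_eq (by omega)]
  have e3 : turanConnCount (n₁ + 1) (a + 1) = starCount c m := by
    simp [turanConnCount, starCount, hT, hB]
  have e4 : turanConnCount (n₂ + 1) (b + 1) = starCount d l := by
    simp [turanConnCount, starCount, hT', hB']
  rw [e1, e2, e3, e4, ← hT, ← hB, ← hT']
  exact this

/-- Deleting a vertex of degree `D` from a graph of order `k + 2`. -/
theorem turanConnCount_add_le {k b D : ℕ} (h : b ≤ k) (hD : k / (b + 1) + 1 ≤ D) (hDk : D ≤ k + 1) :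
    turanConnCount (k + 1) (b + 1) + turanCount (k + 1 - D) b ≤ turanConnCount (k + 2) (b + 1) ∧
    (turanConnCount (k + 1) (b + 1) + turanCount (k + 1 - D) b = turanConnCount (k + 2) (b + 1) →
      b + 1 ∣ k + 1 ∧ D = k / (b + 1) + 1) := by
  obtain ⟨h1, h2⟩ := centerCount_le_succ k b h
  have h3 : turanCount (k + 1 - D) b ≤ turanCount (k - k / (b + 1)) b :=
    (turanCount_strictMono b).monotone (by omega)
  have h4 := turanCount_succ_succ k b
  have e1 : turanConnCount (k + 1) (b + 1) = turanCount k (b + 1) + centerCount k (b + 1) := rfl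
  have e2 : turanConnCount (k + 2) (b + 1) =
    turanCount (k + 1) (b + 1) + centerCount (k + 1) (b + 1) := rfl
  refine ⟨by omega, fun he => ⟨h2 (by omega), ?_⟩⟩
  have h5 : k + 1 - D = k - k / (b + 1) := by
    refine (turanCount_strictMono b).injective ?_
    omega
  omega

theorem turanConnCount_one (k : ℕ) : turanConnCount (k + 1) 1 = turanCount (k + 1) 1 := by
  simp [turanConnCount, turanCount, centerCount, Nat.mod_one]

/-- For a balanced family with sum `m`, the product over all indices but one is `centerCount` if a
smallest value is omitted, and is smaller if a larger one is omitted. -/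
theorem prod_erase_eq_centerCount {m b : ℕ} {f : Fin (b + 1) → ℕ}
    (hf : ∀ i, f i = m / (b + 1) ∨ f i = m / (b + 1) + 1) (hs : ∑ i, f i = m) (j : Fin (b + 1)) :
    (f j = m / (b + 1) → ∏ i ∈ univ.erase j, f i = centerCount m (b + 1)) ∧
    (f j = m / (b + 1) + 1 → 0 < m / (b + 1) →
      ∏ i ∈ univ.erase j, f i < centerCount m (b + 1)) := by
  obtain ⟨q, r, hr, e⟩ := exists_eq_mul_add m b
  have hq : m / (b + 1) = q := by
    rw [e, mul_comm, Nat.mul_add_div (by omega), Nat.div_eq_of_lt (by omega), add_zero]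
  rw [hq] at hf ⊢
  rw [e, centerCount_eq hr]
  have h1 := add_sum_erase univ f (mem_univ j)
  have hc : #(univ.erase j) = b := by simp
  rw [hs, e] at h1
  constructor
  · intro hj
    have h2 := (prod_of_two_values (univ.erase j) f (fun i _ => hf i) (q := q) (r := r)
      (by rw [hc]; rw [hj] at h1; nlinarith) 0).2
    rw [hc] at h2
    simpa using h2
  · intro hj hq0
    obtain ⟨h3, h2⟩ := prod_of_two_values univ f (fun i _ => hf i) (q := q) (r := r)
      (by rw [hs, e]; simp) 0
    obtain ⟨r, rfl⟩ : ∃ r', r = r' + 1 := ⟨r - 1, by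
      have h4 : q * #(univ.erase j) ≤ ∑ i ∈ univ.erase j, f i := by
        rw [mul_comm, ← smul_eq_mul]
        exact card_nsmul_le_sum _ _ _ fun i _ => by rcases hf i with e | e <;> omega
      rw [hc] at h4
      have : 0 < r := by nlinarith
      omega⟩
    have h2 := (prod_of_two_values (univ.erase j) f (fun i _ => hf i) (q := q) (r := r)
      (by rw [hc]; rw [hj] at h1; nlinarith) 0).2
    rw [hc] at h2
    simp only [add_zero] at h2
    rw [h2]
    obtain ⟨k, rfl⟩ := Nat.exists_eq_add_of_le hr
    have e1 : r + 1 + k - r = k + 1 := by omega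
    have e2 : r + 1 + k - (r + 1) = k := by omega
    rw [e1, e2, pow_succ, pow_succ]
    have : 0 < (q + 1) ^ r * q ^ k := by positivity
    nlinarith

/-- The count across a bridge, `(g₁ + h₁) g₂ + g₁ h₂`, is increasing in the numbers of stable sets
of the two sides and in the numbers of those avoiding the ends of the bridge. -/
theorem bridge_count_le {g₁ h₁ g₂ h₂ T₁ B₁ T₂ B₂ : ℕ} (hg₂ : 0 < g₂) (hh₂ : 0 < h₂) (hT : 0 < T₁)
    (hB : 0 < B₁) (h1 : g₁ ≤ T₁) (h2 : g₁ + h₁ ≤ T₁ + B₁) (h3 : g₂ ≤ T₂)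
    (h4 : g₂ + h₂ ≤ T₂ + B₂) :
    g₁ * (g₂ + h₂) + h₁ * g₂ ≤ T₁ * (T₂ + B₂) + B₁ * T₂ ∧
    (g₁ * (g₂ + h₂) + h₁ * g₂ = T₁ * (T₂ + B₂) + B₁ * T₂ →
      g₁ = T₁ ∧ g₁ + h₁ = T₁ + B₁ ∧ g₂ = T₂ ∧ g₂ + h₂ = T₂ + B₂) := by
  have p1 : g₁ * h₂ ≤ T₁ * h₂ := Nat.mul_le_mul_right _ h1
  have p2 : (g₁ + h₁) * g₂ ≤ (T₁ + B₁) * g₂ := Nat.mul_le_mul_right _ h2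
  have p3 : T₁ * (g₂ + h₂) ≤ T₁ * (T₂ + B₂) := Nat.mul_le_mul_left _ h4
  have p4 : B₁ * g₂ ≤ B₁ * T₂ := Nat.mul_le_mul_left _ h3
  have e1 : g₁ * (g₂ + h₂) + h₁ * g₂ = g₁ * h₂ + (g₁ + h₁) * g₂ := by ring
  have e2 : T₁ * h₂ + (T₁ + B₁) * g₂ = T₁ * (g₂ + h₂) + B₁ * g₂ := by ring
  rw [e1]
  refine ⟨by omega, fun h => ⟨?_, ?_, ?_, ?_⟩⟩
  · exact Nat.eq_of_mul_eq_mul_right hh₂ (by omega)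
  · exact Nat.eq_of_mul_eq_mul_right hg₂ (by omega)
  · exact Nat.eq_of_mul_eq_mul_left hB (by omega)
  · exact Nat.eq_of_mul_eq_mul_left hT (by omega)

/-- Two families with values `q` and `q + 1` and with the same sum agree up to a permutation, which
can be chosen to match two given indices at which the value is `q`. -/
theorem exists_perm_of_two_values {ι : Type*} [Fintype ι] {f g : ι → ℕ} {q : ℕ}
    (hf : ∀ i, f i = q ∨ f i = q + 1) (hg : ∀ i, g i = q ∨ g i = q + 1)
    (h : ∑ i, f i = ∑ i, g i) {i j : ι} (hi : f i = q) (hj : g j = q) :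
    ∃ σ : Equiv.Perm ι, σ i = j ∧ ∀ k, g (σ k) = f k := by
  classical
  have key : ∀ f : ι → ℕ, (∀ i, f i = q ∨ f i = q + 1) →
      ∑ i, f i = Fintype.card ι * q + Fintype.card {i // f i = q + 1} := by
    intro f hf
    rw [Fintype.card_subtype, card_filter, ← card_univ, ← smul_eq_mul, ← sum_const,
      ← sum_add_distrib]
    refine sum_congr rfl fun i _ => ?_
    rcases hf i with e | e <;> simp [e]
  have hcard : Fintype.card {i // f i = q + 1} = Fintype.card {i // g i = q + 1} := by
    have h1 := key f hf
    have h2 := key g hg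
    omega
  let σ := (Fintype.equivOfCardEq hcard).extendSubtype
  have hσ : ∀ k, g (σ k) = f k := by
    intro k
    rcases hf k with e | e
    · have := (Fintype.equivOfCardEq hcard).extendSubtype_not_mem k (by omega)
      rw [e]
      exact (hg (σ k)).resolve_right this
    · have := (Fintype.equivOfCardEq hcard).extendSubtype_mem k e
      rw [e]
      exact this
  refine ⟨σ.trans (Equiv.swap (σ i) j), by simp, fun k => ?_⟩
  rw [Equiv.trans_apply]
  by_cases h1 : σ k = σ i
  · rw [h1, Equiv.swap_apply_left, hj, σ.injective h1, hi]
  · by_cases h2 : σ k = j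
    · rw [h2, Equiv.swap_apply_right, hσ, hi, ← hσ k, h2, hj]
    · rw [Equiv.swap_apply_of_ne_of_ne h1 h2, hσ]

namespace SimpleGraph

open scoped Classical in
/-- The number of stable sets of `G` contained in `S`, that is, the Fibonacci index of the subgraph
induced by `S`. -/
noncomputable def numStable {V : Type*} (G : SimpleGraph V) (S : Finset V) : ℕ :=
  #(S.powerset.filter fun s : Finset V => G.IsIndepSet (s : Set V))

/-- Every stable set contained in `S` has at most `a` elements. -/
def StableLE {V : Type*} (G : SimpleGraph V) (S : Finset V) (a : ℕ) : Prop :=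
  ∀ s ⊆ S, G.IsIndepSet (s : Set V) → #s ≤ a

open scoped Classical in
/-- The neighbours of `v` in `S`. -/
noncomputable def nbr {V : Type*} (G : SimpleGraph V) (S : Finset V) (v : V) : Finset V :=
  {w ∈ S | G.Adj v w}

open scoped Classical in
/-- The vertices of `S` outside the closed neighbourhood of `v`. -/
noncomputable def nonNbr {V : Type*} (G : SimpleGraph V) (S : Finset V) (v : V) : Finset V :=
  {w ∈ S | w ≠ v ∧ ¬ G.Adj v w}

/-- The subgraph induced by `S` is connected, expressed by the edges leaving the proper nonempty
subsets of `S`. The empty set is connected in this sense. -/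
def ConnectedOn {V : Type*} (G : SimpleGraph V) (S : Finset V) : Prop :=
  ∀ A ⊆ S, A.Nonempty → A ≠ S → ∃ x ∈ A, ∃ y ∈ S, y ∉ A ∧ G.Adj x y

/-- The stability number of the subgraph induced by `S` is `a`. -/
def HasStability {V : Type*} (G : SimpleGraph V) (S : Finset V) (a : ℕ) : Prop :=
  G.StableLE S a ∧ ∃ s ⊆ S, G.IsIndepSet (s : Set V) ∧ #s = a

section
open scoped Classical
variable {V : Type*} {G : SimpleGraph V} {S : Finset V} {v : V} {a : ℕ}

/-! ### Counting stable sets -/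

theorem isIndepSet_coe {s : Finset V} :
    G.IsIndepSet (s : Set V) ↔ ∀ x ∈ s, ∀ y ∈ s, ¬ G.Adj x y := by
  constructor
  · intro h x hx y hy hxy
    exact h hx hy hxy.ne hxy
  · intro h x hx y hy _
    exact h x hx y hy

theorem isIndepSet_coe_insert {s : Finset V} (hs : G.IsIndepSet (s : Set V))
    (h : ∀ x ∈ s, ¬ G.Adj v x) : G.IsIndepSet ((insert v s : Finset V) : Set V) := by
  rw [isIndepSet_coe] at hs ⊢
  intro x hx y hy
  rcases mem_insert.mp hx with rfl | hx' <;> rcases mem_insert.mp hy with rfl | hy'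
  · exact G.loopless.irrefl _
  · exact h y hy'
  · exact fun hxy => h x hx' hxy.symm
  · exact hs x hx' y hy'

theorem isIndepSet_coe_union {s t : Finset V} (hs : G.IsIndepSet (s : Set V))
    (ht : G.IsIndepSet (t : Set V)) (h : ∀ x ∈ s, ∀ y ∈ t, ¬ G.Adj x y) :
    G.IsIndepSet ((s ∪ t : Finset V) : Set V) := by
  rw [isIndepSet_coe] at *
  intro x hx y hy
  rcases mem_union.mp hx with hx | hx <;> rcases mem_union.mp hy with hy | hy
  · exact hs x hx y hy
  · exact h x hx y hy
  · exact fun hxy => h y hy x hx hxy.symm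
  · exact ht x hx y hy

theorem isIndepSet_coe_mono {s t : Finset V} (hst : s ⊆ t) (ht : G.IsIndepSet (t : Set V)) :
    G.IsIndepSet (s : Set V) :=
  isIndepSet_coe.2 fun x hx y hy => isIndepSet_coe.1 ht x (hst hx) y (hst hy)

theorem mem_nbr {w : V} : w ∈ G.nbr S v ↔ w ∈ S ∧ G.Adj v w := by simp [nbr]

theorem mem_nonNbr {w : V} : w ∈ G.nonNbr S v ↔ w ∈ S ∧ w ≠ v ∧ ¬ G.Adj v w := by simp [nonNbr]

theorem nonNbr_subset : G.nonNbr S v ⊆ S := fun _ h => (mem_nonNbr.1 h).1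

theorem card_nonNbr_add (hv : v ∈ S) : #(G.nonNbr S v) + (#(G.nbr S v) + 1) = #S := by
  have hd : Disjoint (G.nonNbr S v) (insert v (G.nbr S v)) := by
    rw [Finset.disjoint_left]
    intro x hx
    rw [mem_nonNbr] at hx
    rw [mem_insert, mem_nbr]
    tauto
  have hu : G.nonNbr S v ∪ insert v (G.nbr S v) = S := by
    ext x
    rw [mem_union, mem_nonNbr, mem_insert, mem_nbr]
    by_cases hx : x = v
    · subst hx; simp [hv]
    · tauto
  have hn : v ∉ G.nbr S v := by simp [mem_nbr]
  rw [← card_insert_of_notMem hn, ← card_union_of_disjoint hd, hu]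

/-- Stable sets avoiding `v`, plus stable sets containing `v`. -/
theorem numStable_eq (hv : v ∈ S) :
    G.numStable S = G.numStable (S.erase v) + G.numStable (G.nonNbr S v) := by
  unfold numStable
  rw [← card_filter_add_card_filter_not (s := S.powerset.filter
      fun s : Finset V => G.IsIndepSet (s : Set V))
    (fun s => v ∉ s)]
  congr 1
  · congr 1
    ext s
    simp only [mem_filter, mem_powerset, subset_erase]
    tauto
  · refine card_nbij' (fun s => s.erase v) (fun s => insert v s) ?_ ?_ ?_ ?_
    · intro s hs
      simp only [coe_filter, mem_filter, mem_powerset, Set.mem_ofPred_eq, not_not] at hs ⊢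
      obtain ⟨⟨hsS, hs⟩, hvs⟩ := hs
      refine ⟨fun x hx => ?_, isIndepSet_coe_mono (erase_subset _ _) hs⟩
      rw [mem_erase] at hx
      exact mem_nonNbr.2 ⟨hsS hx.2, hx.1, isIndepSet_coe.1 hs v hvs x hx.2⟩
    · intro s hs
      simp only [coe_filter, mem_filter, mem_powerset, Set.mem_ofPred_eq, not_not] at hs ⊢
      exact ⟨⟨insert_subset hv (hs.1.trans nonNbr_subset), isIndepSet_coe_insert hs.2
        fun x hx => (mem_nonNbr.1 (hs.1 hx)).2.2⟩, mem_insert_self _ _⟩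
    · intro s hs
      simp only [coe_filter, mem_filter, mem_powerset, Set.mem_ofPred_eq, not_not] at hs
      exact insert_erase hs.2
    · intro s hs
      simp only [coe_filter, mem_powerset, Set.mem_ofPred_eq] at hs
      exact erase_insert fun h => (mem_nonNbr.1 (hs.1 h)).2.1 rfl

theorem numStable_empty : G.numStable ∅ = 1 := by
  simp [numStable, filter_singleton, isIndepSet_coe]

theorem numStable_pos : 0 < G.numStable S :=
  card_pos.2 ⟨∅, by simp [isIndepSet_coe]⟩

theorem numStable_union {A B : Finset V} (hd : Disjoint A B)
    (h : ∀ x ∈ A, ∀ y ∈ B, ¬ G.Adj x y) :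
    G.numStable (A ∪ B) = G.numStable A * G.numStable B := by
  induction A using Finset.strongInduction with
  | H A ih =>
    rcases A.eq_empty_or_nonempty with rfl | ⟨v, hv⟩
    · simp [numStable_empty]
    · have hvB : v ∉ B := Finset.disjoint_left.1 hd hv
      have e1 : (A ∪ B).erase v = A.erase v ∪ B := by
        rw [erase_union_distrib, erase_eq_of_notMem hvB]
      have e2 : G.nonNbr (A ∪ B) v = G.nonNbr A v ∪ B := by
        ext x
        simp only [mem_nonNbr, mem_union]
        have : x ∈ B → x ≠ v := fun hx e => hvB (e ▸ hx)
        have := h v hv x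
        tauto
      have hs : G.nonNbr A v ⊂ A :=
        ⟨nonNbr_subset, fun hA => (mem_nonNbr.1 (hA hv)).2.1 rfl⟩
      rw [numStable_eq (mem_union_left _ hv), e1, e2, numStable_eq hv,
        ih _ (erase_ssubset hv) (hd.mono_left (erase_subset _ _))
          (fun x hx => h x (mem_of_mem_erase hx)),
        ih _ hs (hd.mono_left nonNbr_subset) (fun x hx => h x (nonNbr_subset hx))]
      ring

/-! ### Stability number and degrees -/

theorem StableLE.mono {T : Finset V} (h : G.StableLE S a) (hT : T ⊆ S) : G.StableLE T a :=
  fun s hs => h s (hs.trans hT)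

theorem StableLE.nonNbr (h : G.StableLE S (a + 1)) (hv : v ∈ S) : G.StableLE (G.nonNbr S v) a := by
  intro s hs hi
  have h1 := h (insert v s) (insert_subset hv (hs.trans nonNbr_subset))
    (isIndepSet_coe_insert hi fun x hx => (mem_nonNbr.1 (hs hx)).2.2)
  rw [card_insert_of_notMem fun hvs => (mem_nonNbr.1 (hs hvs)).2.1 rfl] at h1
  omega

theorem StableLE.eq_empty (h : G.StableLE S 0) : S = ∅ := by
  by_contra! hS
  obtain ⟨v, hv⟩ := hS
  have := h {v} (by simpa using hv) (by simp)
  simp at this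

/-- Deleting closed neighbourhoods one after the other builds a stable set. -/
theorem StableLE.card_le {D : ℕ} (h : G.StableLE S a) (hD : ∀ v ∈ S, #(G.nbr S v) ≤ D) :
    #S ≤ a * (D + 1) := by
  induction a generalizing S with
  | zero => simp [h.eq_empty]
  | succ a ih =>
    rcases S.eq_empty_or_nonempty with rfl | ⟨v, hv⟩
    · simp
    · have h1 := ih (h.nonNbr hv) fun w hw =>
        (card_le_card (filter_subset_filter _ nonNbr_subset)).trans (hD w (nonNbr_subset hw))
      have h2 := card_nonNbr_add (G := G) hv
      have h3 := hD v hv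
      nlinarith

/-- In a connected graph every closed neighbourhood except the first can be chosen so as to meet the
previous ones, which saves one vertex each time. -/
theorem ConnectedOn.card_le {D : ℕ} (hc : G.ConnectedOn S) (hS : S.Nonempty) (h : G.StableLE S a)
    (hD : ∀ v ∈ S, #(G.nbr S v) ≤ D) : #S ≤ a * D + 1 := by
  let N : Finset V → Finset V := fun I => {w ∈ S | ∃ i ∈ I, w = i ∨ G.Adj i w}
  let P : Finset (Finset V) :=
    S.powerset.filter fun I : Finset V =>
      G.IsIndepSet (I : Set V) ∧ I.Nonempty ∧ #(N I) ≤ #I * D + 1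
  have hP : P.Nonempty := by
    obtain ⟨v, hv⟩ := hS
    refine ⟨{v}, ?_⟩
    simp only [P, mem_filter, mem_powerset, singleton_subset_iff, hv, singleton_nonempty,
      card_singleton, one_mul, true_and]
    refine ⟨by simp, ?_⟩
    have : N {v} ⊆ insert v (G.nbr S v) := by
      intro w hw
      simp only [N, mem_filter, mem_singleton, exists_eq_left] at hw
      rw [mem_insert, mem_nbr]
      tauto
    have h1 := (card_le_card this).trans (card_insert_le _ _)
    have h2 := hD v hv
    omega
  obtain ⟨I, hI, hmax⟩ := exists_max_image P card hP
  simp only [P, mem_filter, mem_powerset] at hI hmax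
  obtain ⟨hIS, hIi, ⟨i, hi⟩, hIc⟩ := hI
  by_cases hN : N I = S
  · rw [hN] at hIc
    have := Nat.mul_le_mul_right D (h I hIS hIi)
    omega
  · obtain ⟨x, hx, y, hy, hyN, hxy⟩ := hc (N I) (filter_subset _ _)
      ⟨i, mem_filter.2 ⟨hIS hi, i, hi, Or.inl rfl⟩⟩ hN
    have hy' : ∀ i ∈ I, y ≠ i ∧ ¬ G.Adj i y := by
      intro i hi
      constructor
      · rintro rfl; exact hyN (mem_filter.2 ⟨hy, y, hi, Or.inl rfl⟩)
      · intro hiy; exact hyN (mem_filter.2 ⟨hy, i, hi, Or.inr hiy⟩)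
    have hyI : y ∉ I := fun hyI => (hy' y hyI).1 rfl
    have hxS : x ∈ S := (mem_filter.1 hx).1
    have hsub : N (insert y I) ⊆ N I ∪ (insert y (G.nbr S y)).erase x := by
      intro w hw
      obtain ⟨hwS, j, hj, hw⟩ := mem_filter.1 hw
      rcases mem_insert.1 hj with rfl | hj
      · by_cases hwx : w = x
        · exact mem_union_left _ (hwx ▸ hx)
        · refine mem_union_right _ (mem_erase.2 ⟨hwx, ?_⟩)
          rw [mem_insert, mem_nbr]; tauto
      · exact mem_union_left _ (mem_filter.2 ⟨hwS, j, hj, hw⟩)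
    have hxm : x ∈ insert y (G.nbr S y) := mem_insert_of_mem (mem_nbr.2 ⟨hxS, hxy.symm⟩)
    have h1 := (card_le_card hsub).trans (card_union_le _ _)
    rw [card_erase_of_mem hxm] at h1
    have h2 := card_insert_le y (G.nbr S y)
    have h3 := hD y hy
    have h4 := hmax (insert y I) ⟨insert_subset hy hIS,
      isIndepSet_coe_insert hIi fun j hj hyj => (hy' j hj).2 hyj.symm, insert_nonempty _ _, by
        rw [card_insert_of_notMem hyI, Nat.succ_mul]; omega⟩
    rw [card_insert_of_notMem hyI] at h4
    omega

theorem exists_max_nbr (G : SimpleGraph V) (hS : S.Nonempty) :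
    ∃ v ∈ S, ∀ w ∈ S, #(G.nbr S w) ≤ #(G.nbr S v) :=
  exists_max_image S (fun v => #(G.nbr S v)) hS

/-! ### The Turán bound -/

theorem StableLE.exists_succ (h : G.StableLE S a) (hS : S.Nonempty) : ∃ b, a = b + 1 := by
  cases a with
  | zero => exact absurd h.eq_empty hS.ne_empty
  | succ b => exact ⟨b, rfl⟩

/-- Among all graphs of given order and stability number, the Turán graph has the most stable
sets. -/
theorem StableLE.numStable_le (h : G.StableLE S a) : G.numStable S ≤ turanCount (#S) a := by
  induction S using Finset.strongInduction generalizing a with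
  | H S ih =>
    rcases S.eq_empty_or_nonempty with rfl | hS
    · rw [numStable_empty]; exact turanCount_pos _ _
    · obtain ⟨v, hv, hmax⟩ := exists_max_nbr G hS
      obtain ⟨b, rfl⟩ := h.exists_succ hS
      have h1 := h.card_le hmax
      have h2 := card_nonNbr_add (G := G) hv
      have h3 := card_erase_add_one hv
      -- A vertex of maximum degree has degree at least `(#S - 1) / (b + 1)`, the degree in a largest
      -- clique of the Turán graph, so the recursion for `turanCount` bounds both summands.
      have hs : G.nonNbr S v ⊂ S := ⟨nonNbr_subset, fun hA => (mem_nonNbr.1 (hA hv)).2.1 rfl⟩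
      have h4 := ih _ (erase_ssubset hv) (h.mono (erase_subset _ _))
      have h5 := ih _ hs (h.nonNbr hv)
      rw [numStable_eq hv, ← h3, turanCount_succ_succ]
      have h6 : #(S.erase v) / (b + 1) ≤ #(G.nbr S v) :=
        Nat.lt_succ_iff.1 ((Nat.div_lt_iff_lt_mul (by omega)).2 (by
          rw [Nat.succ_eq_add_one, mul_comm]; omega))
      have h7 : #(G.nonNbr S v) ≤ #(S.erase v) - #(S.erase v) / (b + 1) := by omega
      have h8 := (turanCount_strictMono b).monotone h7
      omega

/-- `S` induces a disjoint union of cliques, the cliques being the colour classes of `κ`. -/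
def IsCliqueUnion {ι : Type*} (G : SimpleGraph V) (S : Finset V) (κ : V → ι) : Prop :=
  ∀ x ∈ S, ∀ y ∈ S, x ≠ y → (G.Adj x y ↔ κ x = κ y)

/-- The vertices of `S` of colour `i`. -/
noncomputable def colorClass {ι : Type*} (S : Finset V) (κ : V → ι) (i : ι) : Finset V :=
  {x ∈ S | κ x = i}

theorem mem_colorClass {ι : Type*} {κ : V → ι} {i : ι} {x : V} :
    x ∈ colorClass S κ i ↔ x ∈ S ∧ κ x = i := by simp [colorClass]

/-- The number of vertices of `S` of colour `i`. -/
noncomputable def colorCard {ι : Type*} (S : Finset V) (κ : V → ι) (i : ι) : ℕ :=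
  #(colorClass S κ i)

theorem sum_colorCard {ι : Type*} [Fintype ι] (S : Finset V) (κ : V → ι) :
    ∑ i, colorCard S κ i = #S :=
  (card_eq_sum_card_fiberwise (fun _ _ => mem_coe.2 (mem_univ _))).symm

theorem IsCliqueUnion.mono {ι : Type*} {κ : V → ι} {T : Finset V} (h : G.IsCliqueUnion S κ)
    (hT : T ⊆ S) : G.IsCliqueUnion T κ :=
  fun x hx y hy => h x (hT hx) y (hT hy)

theorem IsCliqueUnion.numStable_eq_prod {ι : Type*} [Fintype ι] {κ : V → ι}
    (h : G.IsCliqueUnion S κ) : G.numStable S = ∏ i, (colorCard S κ i + 1) := by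
  induction S using Finset.strongInduction with
  | H S ih =>
    rcases S.eq_empty_or_nonempty with rfl | ⟨v, hv⟩
    · simp [numStable_empty, colorCard, colorClass]
    · have hs : G.nonNbr S v ⊂ S := ⟨nonNbr_subset, fun hA => (mem_nonNbr.1 (hA hv)).2.1 rfl⟩
      rw [numStable_eq hv, ih _ (erase_ssubset hv) (h.mono (erase_subset _ _)),
        ih _ hs (h.mono nonNbr_subset)]
      rw [← mul_prod_erase univ _ (mem_univ (κ v)), ← mul_prod_erase univ _ (mem_univ (κ v)),
        ← mul_prod_erase univ _ (mem_univ (κ v))]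
      have e1 : ∀ i ∈ univ.erase (κ v), colorCard (S.erase v) κ i + 1 = colorCard S κ i + 1 := by
        intro i hi
        unfold colorCard colorClass
        rw [filter_erase, erase_eq_of_notMem]
        simp only [mem_filter, not_and]
        exact fun _ e => (mem_erase.1 hi).1 e.symm
      have e2 : ∀ i ∈ univ.erase (κ v), colorCard (G.nonNbr S v) κ i + 1 = colorCard S κ i + 1 := by
        intro i hi
        unfold colorCard
        congr 2
        ext x
        simp only [mem_colorClass, mem_nonNbr]
        constructor
        · tauto
        · rintro ⟨hx, rfl⟩
          have hxv : v ≠ x := fun e => (mem_erase.1 hi).1 (e ▸ rfl)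
          refine ⟨⟨hx, hxv.symm, ?_⟩, rfl⟩
          rw [h v hv x hx hxv]
          exact fun e => (mem_erase.1 hi).1 e.symm
      have e3 : colorCard (G.nonNbr S v) κ (κ v) = 0 := by
        unfold colorCard colorClass
        rw [card_eq_zero, filter_eq_empty_iff]
        intro x hx e
        obtain ⟨hx, hxv, hn⟩ := mem_nonNbr.1 hx
        exact hn ((h v hv x hx hxv.symm).2 e.symm)
      have e4 : colorCard (S.erase v) κ (κ v) + 1 = colorCard S κ (κ v) := by
        unfold colorCard colorClass
        rw [filter_erase]
        exact card_erase_add_one (by simp [hv])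
      rw [prod_congr rfl e1, prod_congr rfl e2, e3, ← e4]
      ring

/-- A stable transversal of the colour classes: if every class contains an element satisfying `p`,
then there is a stable set of such elements, one of each colour. -/
theorem IsCliqueUnion.exists_transversal {ι : Type*} [Fintype ι] {κ : V → ι}
    (h : G.IsCliqueUnion S κ) {p : V → Prop} (hp : ∀ i, ∃ x ∈ S, κ x = i ∧ p x) :
    ∃ s ⊆ S, G.IsIndepSet (s : Set V) ∧ (∀ x ∈ s, p x) ∧ #s = Fintype.card ι := by
  choose f hfS hfκ hfp using hp
  refine ⟨univ.image f, ?_, ?_, ?_, ?_⟩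
  · intro x hx
    obtain ⟨i, -, rfl⟩ := mem_image.1 hx
    exact hfS i
  · rw [isIndepSet_coe]
    intro x hx y hy hxy
    obtain ⟨i, -, rfl⟩ := mem_image.1 hx
    obtain ⟨j, -, rfl⟩ := mem_image.1 hy
    have hij := (h _ (hfS i) _ (hfS j) hxy.ne).1 hxy
    rw [hfκ, hfκ] at hij
    exact hxy.ne (congrArg f hij)
  · intro x hx
    obtain ⟨i, -, rfl⟩ := mem_image.1 hx
    exact hfp i
  · rw [card_image_of_injective _ (fun i j e => by rw [← hfκ i, ← hfκ j, e]), card_univ]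

/-- If `S \ {v}` is a union of `a` cliques and adding `v` does not produce a stable set of size
`a + 1`, then one of the cliques is contained in the neighbourhood of `v`. -/
theorem IsCliqueUnion.exists_color_subset_nbr {κ : V → Fin a} (h : G.IsCliqueUnion (S.erase v) κ)
    (hv : v ∈ S) (ha : G.StableLE S a) : ∃ i, ∀ x ∈ S.erase v, κ x = i → G.Adj v x := by
  by_contra! hcon
  obtain ⟨s, hs, hi, hp, hcard⟩ := h.exists_transversal (p := fun x => ¬ G.Adj v x) hcon
  have h1 := ha (insert v s) (insert_subset hv (hs.trans (erase_subset _ _)))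
    (isIndepSet_coe_insert hi hp)
  rw [card_insert_of_notMem fun hvs => (mem_erase.1 (hs hvs)).1 rfl, hcard, Fintype.card_fin] at h1
  omega

/-- Equality in the Turán bound forces a disjoint union of balanced cliques. -/
theorem StableLE.exists_isCliqueUnion (h : G.StableLE S (a + 1))
    (he : G.numStable S = turanCount (#S) (a + 1)) :
    ∃ κ : V → Fin (a + 1), G.IsCliqueUnion S κ ∧
      ∀ i j, colorCard S κ i ≤ colorCard S κ j + 1 := by
  induction S using Finset.strongInduction with
  | H S ih =>
    rcases S.eq_empty_or_nonempty with rfl | hS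
    · exact ⟨fun _ => 0, fun x hx => by simp at hx, by simp [colorCard, colorClass]⟩
    · obtain ⟨v, hv, hmax⟩ := exists_max_nbr G hS
      have h1 := h.card_le hmax
      have h2 := card_nonNbr_add (G := G) hv
      have h3 := card_erase_add_one hv
      have h4 := (h.mono (erase_subset v S)).numStable_le
      have h5 := (h.nonNbr hv).numStable_le
      rw [numStable_eq hv, ← h3, turanCount_succ_succ] at he
      have h6 : #(S.erase v) / (a + 1) ≤ #(G.nbr S v) :=
        Nat.lt_succ_iff.1 ((Nat.div_lt_iff_lt_mul (by omega)).2 (by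
          rw [Nat.succ_eq_add_one, mul_comm]; omega))
      have h7 : #(G.nonNbr S v) ≤ #(S.erase v) - #(S.erase v) / (a + 1) := by omega
      have h8 := (turanCount_strictMono a).monotone h7
      have h9 : #(G.nonNbr S v) = #(S.erase v) - #(S.erase v) / (a + 1) := by
        refine (turanCount_strictMono a).injective ?_
        omega
      obtain ⟨κ, hκ, hbal⟩ := ih _ (erase_ssubset hv) (h.mono (erase_subset v S)) (by omega)
      -- By equality `v` has degree `#(S.erase v) / (a + 1)`, which leaves no room for neighbours
      -- outside the clique that its neighbourhood contains. So `v` extends this clique.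
      obtain ⟨i, hi⟩ := hκ.exists_color_subset_nbr hv h
      have hlow := fun j => div_le_of_balanced hbal (sum_colorCard _ κ) j
      have hsub : colorClass (S.erase v) κ i ⊆ G.nbr S v := by
        intro x hx
        rw [mem_colorClass] at hx
        exact mem_nbr.2 ⟨mem_of_mem_erase hx.1, hi x hx.1 hx.2⟩
      have hci : colorCard (S.erase v) κ i = #(colorClass (S.erase v) κ i) := rfl
      have heq : colorClass (S.erase v) κ i = G.nbr S v :=
        eq_of_subset_of_card_le hsub (by have := (hlow i).1; omega)
      have hcard : colorCard (S.erase v) κ i = #(S.erase v) / (a + 1) := by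
        have := card_le_card hsub
        have := (hlow i).1
        omega
      have hadj : ∀ x ∈ S, x ≠ v → (G.Adj v x ↔ κ x = i) := by
        intro x hx hxv
        have : x ∈ G.nbr S v ↔ x ∈ colorClass (S.erase v) κ i := by rw [heq]
        rw [mem_nbr, mem_colorClass, mem_erase] at this
        tauto
      have hne : ∀ x, x ≠ v → Function.update κ v i x = κ x := fun x hx =>
        Function.update_of_ne hx _ _
      have hcne : ∀ j, j ≠ i → colorCard S (Function.update κ v i) j =
          colorCard (S.erase v) κ j := by
        intro j hj
        unfold colorCard
        congr 1
        ext x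
        rw [mem_colorClass, mem_colorClass, mem_erase]
        by_cases hx : x = v
        · subst hx; simp [hj.symm]
        · rw [hne x hx]; tauto
      have hce : colorCard S (Function.update κ v i) i = colorCard (S.erase v) κ i + 1 := by
        unfold colorCard
        rw [← card_insert_of_notMem (a := v) (by simp [mem_colorClass])]
        congr 1
        ext x
        rw [mem_insert, mem_colorClass, mem_colorClass, mem_erase]
        by_cases hx : x = v
        · subst hx; simp [hv]
        · rw [hne x hx]; tauto
      refine ⟨Function.update κ v i, ?_, ?_⟩
      · intro x hx y hy hxy
        by_cases hxv : x = v
        · subst hxv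
          rw [Function.update_self, hne y hxy.symm, hadj y hy hxy.symm, eq_comm]
        · by_cases hyv : y = v
          · subst hyv
            rw [Function.update_self, hne x hxy, G.adj_comm, hadj x hx hxy]
          · rw [hne x hxv, hne y hyv]
            exact hκ x (mem_erase.2 ⟨hxv, hx⟩) y (mem_erase.2 ⟨hyv, hy⟩) hxy
      · intro j k
        have hj := hlow j
        have hk := hlow k
        have hjk := hbal j k
        by_cases ej : j = i <;> by_cases ek : k = i
        · subst ej; subst ek; omega
        · subst ej; rw [hce, hcne k ek]; omega
        · subst ek; rw [hce, hcne j ej]; omega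
        · rw [hcne j ej, hcne k ek]; exact hjk

/-! ### Bridges and critical edges -/

theorem exists_hasStability (G : SimpleGraph V) (S : Finset V) : ∃ a, G.HasStability S a := by
  obtain ⟨s, hs, hmax⟩ := exists_max_image
    (S.powerset.filter fun s : Finset V => G.IsIndepSet (s : Set V)) card ⟨∅, by simp⟩
  simp only [mem_filter, mem_powerset] at hs hmax
  exact ⟨#s, fun t ht hi => hmax t ⟨ht, hi⟩, s, hs.1, hs.2, rfl⟩

theorem HasStability.exists_succ (h : G.HasStability S a) (hS : S.Nonempty) : ∃ b, a = b + 1 :=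
  h.1.exists_succ hS

theorem HasStability.le_card (h : G.HasStability S a) : a ≤ #S := by
  obtain ⟨s, hs, -, rfl⟩ := h.2
  exact card_le_card hs

theorem ConnectedOn.exists_adj (hc : G.ConnectedOn S) (hv : v ∈ S) (hS : 2 ≤ #S) :
    ∃ w ∈ S, G.Adj v w := by
  obtain ⟨x, hx, y, hy, -, hxy⟩ := hc {v} (by simpa using hv) (by simp) (by
    rintro rfl; simp at hS)
  rw [mem_singleton] at hx
  exact ⟨y, hy, hx ▸ hxy⟩

theorem ConnectedOn.lt_card (hc : G.ConnectedOn S) (h : G.HasStability S a) (hS : 2 ≤ #S) :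
    a < #S := by
  refine lt_of_le_of_ne h.le_card ?_
  rintro rfl
  obtain ⟨s, hs, hi, hcard⟩ := h.2
  obtain rfl := eq_of_subset_of_card_le hs hcard.ge
  obtain ⟨v, hv⟩ : s.Nonempty := card_pos.1 (by omega)
  obtain ⟨w, hw, hvw⟩ := hc.exists_adj hv hS
  exact isIndepSet_coe.1 hi v hv w hw hvw

theorem numStable_lt_of_le {H : SimpleGraph V} (hle : H ≤ G) {s : Finset V} (hs : s ⊆ S)
    (hi : H.IsIndepSet (s : Set V)) (hn : ¬ G.IsIndepSet (s : Set V)) :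
    G.numStable S < H.numStable S := by
  refine card_lt_card ⟨fun t ht => ?_, fun hsub => ?_⟩
  · rw [mem_filter] at ht ⊢
    exact ⟨ht.1, isIndepSet_coe.2 fun u hu w hw h => isIndepSet_coe.1 ht.2 u hu w hw (hle h)⟩
  · exact hn (mem_filter.1 (hsub (mem_filter.2 ⟨mem_powerset.2 hs, hi⟩))).2

theorem numStable_lt_deleteEdges {x y : V} (hx : x ∈ S) (hy : y ∈ S) (hxy : G.Adj x y) :
    G.numStable S < (G.deleteEdges {s(x, y)}).numStable S := by
  refine numStable_lt_of_le (deleteEdges_le _) (s := {x, y}) ?_ ?_ ?_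
  · simp [insert_subset_iff, hx, hy]
  · rw [isIndepSet_coe]
    intro u hu w hw huw
    rw [deleteEdges_adj, Set.mem_singleton_iff] at huw
    have hne := huw.1.ne
    rw [mem_insert, mem_singleton] at hu hw
    rcases hu with rfl | rfl <;> rcases hw with rfl | rfl
    · exact hne rfl
    · exact huw.2 rfl
    · exact huw.2 Sym2.eq_swap
    · exact hne rfl
  · exact fun h => isIndepSet_coe.1 h x (by simp) y (by simp) hxy

/-- If deleting the edge `xy` increases the stability number, some set larger than all stable sets
has `xy` as its only edge. -/
theorem exists_of_not_stableLE_deleteEdges {x y : V} (h : G.StableLE S a)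
    (hn : ¬ (G.deleteEdges {s(x, y)}).StableLE S a) :
    ∃ s ⊆ S, x ∈ s ∧ y ∈ s ∧ a + 1 ≤ #s ∧ G.IsIndepSet ((s.erase x : Finset V) : Set V) ∧
      G.IsIndepSet ((s.erase y : Finset V) : Set V) := by
  unfold StableLE at hn
  push Not at hn
  obtain ⟨s, hs, hi, hcard⟩ := hn
  rw [isIndepSet_coe] at hi
  have key : ∀ u ∈ s, ∀ w ∈ s, G.Adj u w → u = x ∧ w = y ∨ u = y ∧ w = x := by
    intro u hu w hw huw
    have := hi u hu w hw
    rw [deleteEdges_adj] at this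
    rw [Set.mem_singleton_iff, Sym2.eq_iff] at this
    tauto
  have hx : G.IsIndepSet ((s.erase x : Finset V) : Set V) := by
    rw [isIndepSet_coe]
    intro u hu w hw huw
    rw [mem_erase] at hu hw
    have := key u hu.2 w hw.2 huw
    tauto
  have hy : G.IsIndepSet ((s.erase y : Finset V) : Set V) := by
    rw [isIndepSet_coe]
    intro u hu w hw huw
    rw [mem_erase] at hu hw
    have := key u hu.2 w hw.2 huw
    tauto
  refine ⟨s, hs, ?_, ?_, hcard, hx, hy⟩
  · by_contra hxs
    rw [erase_eq_of_notMem hxs] at hx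
    have := h s hs hx
    omega
  · by_contra hys
    rw [erase_eq_of_notMem hys] at hy
    have := h s hs hy
    omega

/-- A connected graph all of whose edges are critical has no cut vertex. If `v` separated `A` from
`B`, then the sets witnessing that an edge from `v` to `A` and an edge from `v` to `B` are critical
could be recombined to two stable sets, one of which would be too large. -/
theorem ConnectedOn.erase (hc : G.ConnectedOn S) (h : G.StableLE S a) (hv : v ∈ S)
    (hcrit : ∀ x ∈ S, ∀ y ∈ S, G.Adj x y → ¬ (G.deleteEdges {s(x, y)}).StableLE S a) :
    G.ConnectedOn (S.erase v) := by
  intro A hA hAne hAS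
  by_contra! hno
  have hAS' : A ⊆ S := hA.trans (erase_subset _ _)
  have hvA : v ∉ A := fun hvA => (mem_erase.1 (hA hvA)).1 rfl
  have hB : ∃ z ∈ S, z ≠ v ∧ z ∉ A := by
    by_contra! hB
    exact hAS (hA.antisymm fun z hz => hB z (mem_of_mem_erase hz) (mem_erase.1 hz).1)
  obtain ⟨z, hz, hzv, hzA⟩ := hB
  obtain ⟨x, hx, y, hy, hyA, hxy⟩ := hc A hAS' hAne (fun e => hvA (e ▸ hv))
  obtain rfl : y = v := by
    by_contra hyv
    exact hno x hx y (mem_erase.2 ⟨hyv, hy⟩) hyA hxy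
  obtain ⟨u, hu, w, hw, hwn, huw⟩ := hc (insert y A) (insert_subset hy hAS') (insert_nonempty _ _)
    (fun e => by
      rw [← e, mem_insert] at hz
      tauto)
  obtain ⟨hwy, hwA⟩ : w ≠ y ∧ w ∉ A := by
    rw [mem_insert] at hwn; tauto
  obtain rfl : u = y := by
    rcases mem_insert.1 hu with h | h
    · exact h
    · exact absurd huw (hno u h w (mem_erase.2 ⟨hwy, hw⟩) hwA)
  obtain ⟨s, hsS, hus, hxs, hs, hsu, hsx⟩ :=
    exists_of_not_stableLE_deleteEdges h (hcrit u hy x (hAS' hx) hxy.symm)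
  obtain ⟨t, htS, hut, hwt, ht, htu, htw⟩ :=
    exists_of_not_stableLE_deleteEdges h (hcrit u hy w hw huw)
  have hcross : ∀ p ∈ A, ∀ q ∈ S, q ≠ u → q ∉ A → ¬ G.Adj p q := fun p hp q hq hqu hqA =>
    hno p hp q (mem_erase.2 ⟨hqu, hq⟩) hqA
  have h1 := h ({p ∈ s.erase u | p ∈ A} ∪ {p ∈ t.erase u | p ∉ A})
    (union_subset ((filter_subset _ _).trans ((erase_subset _ _).trans hsS))
      ((filter_subset _ _).trans ((erase_subset _ _).trans htS)))
    (isIndepSet_coe_union (isIndepSet_coe_mono (filter_subset _ _) hsu)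
      (isIndepSet_coe_mono (filter_subset _ _) htu) fun p hp q hq => by
        rw [mem_filter, mem_erase] at hp hq
        exact hcross p hp.2 q (htS hq.1.2) hq.1.1 hq.2)
  have h2 := h ({p ∈ t.erase w | p ∈ A} ∪ {p ∈ s.erase x | p ∉ A})
    (union_subset ((filter_subset _ _).trans ((erase_subset _ _).trans htS))
      ((filter_subset _ _).trans ((erase_subset _ _).trans hsS)))
    (isIndepSet_coe_union (isIndepSet_coe_mono (filter_subset _ _) htw)
      (isIndepSet_coe_mono (filter_subset _ _) hsx) fun p hp q hq => by
        rw [mem_filter, mem_erase] at hp hq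
        by_cases hqu : q = u
        · subst hqu
          refine isIndepSet_coe.1 htw p (mem_erase.2 hp.1) q (mem_erase.2 ⟨hwy.symm, hut⟩)
        · exact hcross p hp.2 q (hsS hq.1.2) hqu hq.2)
  have hd : ∀ s t : Finset V, Disjoint {p ∈ s | p ∈ A} {p ∈ t | p ∉ A} := fun s t => by
    rw [Finset.disjoint_left]
    intro p hp hq
    exact (mem_filter.1 hq).2 (mem_filter.1 hp).2
  rw [card_union_of_disjoint (hd _ _)] at h1 h2
  have e1 : #{p ∈ s.erase u | p ∈ A} = #{p ∈ s | p ∈ A} := by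
    rw [filter_erase, erase_eq_of_notMem (by simp [hvA])]
  have e2 : #{p ∈ t.erase u | p ∉ A} + 1 = #{p ∈ t | p ∉ A} := by
    rw [filter_erase, card_erase_add_one (by simp [hvA, hut])]
  have e3 : #{p ∈ t.erase w | p ∈ A} = #{p ∈ t | p ∈ A} := by
    rw [filter_erase, erase_eq_of_notMem (by simp [hwA])]
  have e4 : #{p ∈ s.erase x | p ∉ A} = #{p ∈ s | p ∉ A} := by
    rw [filter_erase, erase_eq_of_notMem (by simp [hx])]
  have e5 := card_filter_add_card_filter_not (s := s) (fun p => p ∈ A)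
  have e6 := card_filter_add_card_filter_not (s := t) (fun p => p ∈ A)
  omega

/-- One side of a partition with a single edge `xy` across it is connected. -/
theorem ConnectedOn.of_bridge {A B : Finset V} {x y : V} (hc : G.ConnectedOn S)
    (hu : A ∪ B = S) (hd : Disjoint A B) (hB : B.Nonempty)
    (h : ∀ u ∈ A, ∀ w ∈ B, G.Adj u w → u = x ∧ w = y) : G.ConnectedOn A := by
  intro C hC hCne hCA
  obtain ⟨z, hz⟩ := hB
  have hAS : A ⊆ S := hu ▸ subset_union_left
  have hzA : z ∉ A := fun hzA => Finset.disjoint_left.1 hd hzA hz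
  have hzS : z ∈ S := hu ▸ mem_union_right _ hz
  by_cases hx : x ∈ C
  · obtain ⟨p, hp, q, hq, hqn, hpq⟩ := hc (A \ C) (sdiff_subset.trans hAS)
      (sdiff_nonempty.2 fun hAC => hCA (hC.antisymm hAC))
      (fun e => hzA (mem_sdiff.1 (e ▸ hzS)).1)
    rw [mem_sdiff] at hp hqn
    rw [← hu, mem_union] at hq
    rcases hq with hq | hq
    · exact ⟨q, by tauto, p, hp.1, hp.2, hpq.symm⟩
    · exact absurd ((h p hp.1 q hq hpq).1 ▸ hx) hp.2
  · obtain ⟨p, hp, q, hq, hqn, hpq⟩ := hc C (hC.trans hAS) hCne (fun e => hzA (hC (e ▸ hzS)))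
    rw [← hu, mem_union] at hq
    rcases hq with hq | hq
    · exact ⟨p, hp, q, hq, hqn, hpq⟩
    · exact absurd ((h p (hC hp) q hq hpq).1 ▸ hp) hx

/-- If deleting the edge `xy` disconnects `S`, then `xy` is the only edge between two parts. -/
theorem ConnectedOn.exists_partition {x y : V} (hc : G.ConnectedOn S)
    (hn : ¬ (G.deleteEdges {s(x, y)}).ConnectedOn S) :
    ∃ A B, A ∪ B = S ∧ Disjoint A B ∧ x ∈ A ∧ y ∈ B ∧
      ∀ u ∈ A, ∀ w ∈ B, G.Adj u w → u = x ∧ w = y := by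
  unfold ConnectedOn at hn
  push Not at hn
  obtain ⟨A, hA, hAne, hAS, hno⟩ := hn
  have key : ∀ u ∈ A, ∀ w ∈ S, w ∉ A → G.Adj u w → u = x ∧ w = y ∨ u = y ∧ w = x := by
    intro u hu w hw hwA huw
    have := hno u hu w hw hwA
    rw [deleteEdges_adj] at this
    rw [Set.mem_singleton_iff, Sym2.eq_iff] at this
    tauto
  obtain ⟨u, hu, w, hw, hwA, huw⟩ := hc A hA hAne hAS
  rcases key u hu w hw hwA huw with ⟨rfl, rfl⟩ | ⟨rfl, rfl⟩
  · refine ⟨A, S \ A, union_sdiff_of_subset hA, disjoint_sdiff, hu, mem_sdiff.2 ⟨hw, hwA⟩, ?_⟩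
    intro p hp q hq hpq
    rw [mem_sdiff] at hq
    rcases key p hp q hq.1 hq.2 hpq with h | ⟨rfl, rfl⟩
    · exact h
    · exact absurd hu hq.2
  · refine ⟨S \ A, A, sdiff_union_of_subset hA, disjoint_sdiff.symm, mem_sdiff.2 ⟨hw, hwA⟩, hu, ?_⟩
    intro p hp q hq hpq
    rw [mem_sdiff] at hp
    rcases key q hq p hp.1 hp.2 hpq.symm with ⟨rfl, rfl⟩ | h
    · exact absurd hq hwA
    · exact h.symm

/-- If `xy` is the only edge between `A` and `B`, a stable set of `A ∪ B` either avoids `x`, or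
contains `x` and avoids `y`. -/
theorem numStable_of_bridge {A B : Finset V} {x y : V} (hd : Disjoint A B) (hx : x ∈ A)
    (hxy : G.Adj x y) (h : ∀ u ∈ A, ∀ w ∈ B, G.Adj u w → u = x ∧ w = y) :
    G.numStable (A ∪ B) = G.numStable (A.erase x) * G.numStable B +
      G.numStable (G.nonNbr A x) * G.numStable (B.erase y) := by
  have hxB : x ∉ B := Finset.disjoint_left.1 hd hx
  have e1 : (A ∪ B).erase x = A.erase x ∪ B := by
    rw [erase_union_distrib, erase_eq_of_notMem hxB]
  have e2 : G.nonNbr (A ∪ B) x = G.nonNbr A x ∪ B.erase y := by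
    ext z
    rw [mem_nonNbr, mem_union, mem_union, mem_nonNbr, mem_erase]
    have h1 : z ∈ B → z ≠ x := fun hz e => hxB (e ▸ hz)
    have h2 : z ∈ B → (G.Adj x z ↔ z = y) := fun hz =>
      ⟨fun hxz => (h x hx z hz hxz).2, fun e => e ▸ hxy⟩
    tauto
  rw [numStable_eq (mem_union_left _ hx), e1, e2, numStable_union, numStable_union]
  · exact (hd.mono_left nonNbr_subset).mono_right (erase_subset _ _)
  · intro u hu w hw huw
    exact (mem_nonNbr.1 hu).2.1 (h u (nonNbr_subset hu) w (mem_of_mem_erase hw) huw).1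
  · exact hd.mono_left (erase_subset _ _)
  · intro u hu w hw huw
    exact (mem_erase.1 hu).1 (h u (mem_of_mem_erase hu) w hw huw).1

/-- The stability number is additive across a bridge whose deletion does not change it. -/
theorem HasStability.add_eq {A B : Finset V} {x y : V} {b c : ℕ} (hS : G.HasStability (A ∪ B) a)
    (hA : G.HasStability A b) (hB : G.HasStability B c) (hd : Disjoint A B)
    (h : ∀ u ∈ A, ∀ w ∈ B, G.Adj u w → u = x ∧ w = y)
    (hsafe : (G.deleteEdges {s(x, y)}).StableLE (A ∪ B) a) : b + c = a := by
  obtain ⟨s, hs, hsi, rfl⟩ := hA.2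
  obtain ⟨t, ht, hti, rfl⟩ := hB.2
  apply le_antisymm
  · rw [← card_union_of_disjoint ((hd.mono_left hs).mono_right ht)]
    refine hsafe _ (union_subset_union hs ht) (isIndepSet_coe_union ?_ ?_ ?_)
    · rw [isIndepSet_coe] at hsi ⊢
      exact fun u hu w hw huw => hsi u hu w hw (deleteEdges_le _ huw)
    · rw [isIndepSet_coe] at hti ⊢
      exact fun u hu w hw huw => hti u hu w hw (deleteEdges_le _ huw)
    · intro u hu w hw huw
      rw [deleteEdges_adj] at huw
      obtain ⟨rfl, rfl⟩ := h u (hs hu) w (ht hw) huw.1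
      exact huw.2 rfl
  · obtain ⟨r, hr, hri, rfl⟩ := hS.2
    have h1 := hA.1 (r ∩ A) inter_subset_right (isIndepSet_coe_mono inter_subset_left hri)
    have h2 := hB.1 (r ∩ B) inter_subset_right (isIndepSet_coe_mono inter_subset_left hri)
    have h3 : #r ≤ #(r ∩ A) + #(r ∩ B) := by
      rw [← card_union_of_disjoint (hd.mono inter_subset_right inter_subset_right),
        ← inter_union_distrib_left, inter_eq_left.2 hr]
    omega

/-! ### The structure of Turán-connected graphs -/

/-- `S` induces a Turán-connected graph with centre `v`: the sets `κ⁻¹ i` are balanced cliques, that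
of `v` being a largest one, and the remaining edges join `v` to one vertex of each other clique.
The sizes are prescribed for the cliques of `S \ {v}`, so that the clique of `v` must have the
smaller one of the two sizes. -/
structure IsTuranConn (G : SimpleGraph V) (S : Finset V) (v : V) (κ : V → Fin a) : Prop where
  mem : v ∈ S
  cliques : G.IsCliqueUnion (S.erase v) κ
  adj_of_color : ∀ x ∈ S.erase v, κ x = κ v → G.Adj v x
  card_nbr_color : ∀ i, i ≠ κ v → colorCard (G.nbr S v) κ i = 1
  card_center : colorCard (S.erase v) κ (κ v) = #(S.erase v) / a
  card_color : ∀ i, colorCard (S.erase v) κ i = #(S.erase v) / a ∨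
    colorCard (S.erase v) κ i = #(S.erase v) / a + 1

theorem colorCard_nonNbr_add {ι : Type*} (κ : V → ι) (i : ι) :
    colorCard (G.nonNbr S v) κ i + colorCard (G.nbr S v) κ i = colorCard (S.erase v) κ i := by
  have hd : Disjoint (colorClass (G.nonNbr S v) κ i) (colorClass (G.nbr S v) κ i) := by
    rw [Finset.disjoint_left]
    intro x hx hy
    rw [mem_colorClass, mem_nonNbr] at hx
    rw [mem_colorClass, mem_nbr] at hy
    tauto
  unfold colorCard
  rw [← card_union_of_disjoint hd]
  congr 1
  ext x
  rw [mem_union, mem_colorClass, mem_colorClass, mem_colorClass, mem_nonNbr, mem_nbr, mem_erase]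
  have : G.Adj v x → x ≠ v := fun h => h.ne'
  tauto

theorem colorCard_nonNbr_eq_zero {ι : Type*} {κ : V → ι} {i : ι}
    (h : ∀ x ∈ S.erase v, κ x = i → G.Adj v x) : colorCard (G.nonNbr S v) κ i = 0 := by
  unfold colorCard
  rw [card_eq_zero, eq_empty_iff_forall_notMem]
  intro x hx
  rw [mem_colorClass, mem_nonNbr] at hx
  exact hx.1.2.2 (h x (mem_erase.2 ⟨hx.1.2.1, hx.1.1⟩) hx.2)

theorem nonNbr_subset_erase : G.nonNbr S v ⊆ S.erase v := fun _ hx =>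
  mem_erase.2 ⟨(mem_nonNbr.1 hx).2.1, (mem_nonNbr.1 hx).1⟩

/-- The number of stable sets containing `v`, if the rest is a union of cliques and `v` is adjacent
to all of the clique `j`. -/
theorem IsCliqueUnion.numStable_nonNbr {ι : Type*} [Fintype ι] [DecidableEq ι] {κ : V → ι} {j : ι}
    (h : G.IsCliqueUnion (S.erase v) κ) (hj : ∀ x ∈ S.erase v, κ x = j → G.Adj v x) :
    G.numStable (G.nonNbr S v) = ∏ i ∈ univ.erase j, (colorCard (G.nonNbr S v) κ i + 1) := by
  rw [(h.mono nonNbr_subset_erase).numStable_eq_prod, ← mul_prod_erase univ _ (mem_univ j),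
    colorCard_nonNbr_eq_zero hj, zero_add, one_mul]

theorem IsTuranConn.numStable_eq {b : ℕ} {κ : V → Fin (b + 1)} (h : G.IsTuranConn S v κ) :
    G.numStable S = turanConnCount (#S) (b + 1) := by
  have h1 := card_erase_add_one h.mem
  have h2 : #S - 1 = #(S.erase v) := by omega
  rw [turanConnCount, h2, SimpleGraph.numStable_eq h.mem]
  congr 1
  · rw [h.cliques.numStable_eq_prod]
    obtain ⟨q, r, hr, e⟩ := exists_eq_mul_add (#(S.erase v)) b
    have hq : #(S.erase v) / (b + 1) = q := by
      rw [e, mul_comm, Nat.mul_add_div (by omega), Nat.div_eq_of_lt (by omega), add_zero]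
    rw [(prod_of_two_values univ _ (fun i _ => h.card_color i) (r := r) (by
      rw [sum_colorCard, hq]; simpa using e) 1).2, hq, e, turanCount_eq (by omega)]
    simp
  · rw [h.cliques.numStable_nonNbr h.adj_of_color, ← (prod_erase_eq_centerCount h.card_color
      (sum_colorCard _ κ) (κ v)).1 h.card_center]
    refine prod_congr rfl fun i hi => ?_
    have h3 := colorCard_nonNbr_add (G := G) (S := S) (v := v) κ i
    rw [h.card_nbr_color i (mem_erase.1 hi).1] at h3
    exact h3

/-- The degree of the centre. -/
theorem IsTuranConn.card_nbr {b : ℕ} {κ : V → Fin (b + 1)} (h : G.IsTuranConn S v κ) :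
    #(G.nbr S v) = #(S.erase v) / (b + 1) + b := by
  rw [← sum_colorCard _ κ, ← add_sum_erase univ _ (mem_univ (κ v)),
    sum_congr rfl (fun i hi => h.card_nbr_color i (mem_erase.1 hi).1), ← h.card_center]
  have := colorCard_nonNbr_add (G := G) (S := S) (v := v) κ (κ v)
  rw [colorCard_nonNbr_eq_zero h.adj_of_color] at this
  simp; omega

/-- A connected extremal graph with a vertex `v` whose deletion leaves a Turán graph is a
Turán-connected graph with centre `v`. Indeed `v` has a neighbour in each clique and is adjacent to
all vertices of one of them, and both summands of the Fibonacci index are known. -/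
theorem ConnectedOn.exists_isTuranConn {b : ℕ} (hc : G.ConnectedOn S)
    (hs : G.HasStability S (b + 1)) (hv : v ∈ S)
    (h : G.numStable (S.erase v) = turanCount (#S - 1) (b + 1))
    (he : G.numStable S = turanConnCount (#S) (b + 1)) :
    ∃ κ : V → Fin (b + 1), G.IsTuranConn S v κ := by
  have h1 := card_erase_add_one hv
  have h2 : #S - 1 = #(S.erase v) := by omega
  rw [turanConnCount, h2, SimpleGraph.numStable_eq hv] at he
  rw [h2] at h
  have hn : G.numStable (G.nonNbr S v) = centerCount (#(S.erase v)) (b + 1) := by omega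
  obtain ⟨κ, hκ, hbal⟩ := (hs.1.mono (erase_subset v S)).exists_isCliqueUnion h
  obtain ⟨j, hj⟩ := hκ.exists_color_subset_nbr hv hs.1
  have hsum := sum_colorCard (S.erase v) κ
  have hcol : ∀ i, colorCard (S.erase v) κ i = #(S.erase v) / (b + 1) ∨
      colorCard (S.erase v) κ i = #(S.erase v) / (b + 1) + 1 := fun i => by
    have := div_le_of_balanced hbal hsum i
    omega
  -- Each nonempty clique is joined to `v` by connectedness.
  have hnbr : ∀ i, 0 < colorCard (S.erase v) κ i → 0 < colorCard (G.nbr S v) κ i := by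
    intro i hi
    obtain ⟨x, hx, y, hy, hyn, hxy⟩ := hc (colorClass (S.erase v) κ i)
      (fun x hx => mem_of_mem_erase (mem_colorClass.1 hx).1) (card_pos.1 hi)
      (fun e => by
        rw [← e, mem_colorClass, mem_erase] at hv
        exact hv.1.1 rfl)
    rw [mem_colorClass] at hx hyn
    have hyv : y = v := by
      by_contra hyv
      have hy' := mem_erase.2 ⟨hyv, hy⟩
      exact hyn ⟨hy', by rw [← hx.2]; exact ((hκ x hx.1 y hy' hxy.ne).1 hxy).symm⟩
    subst hyv
    exact card_pos.2 ⟨x, mem_colorClass.2 ⟨mem_nbr.2 ⟨mem_of_mem_erase hx.1, hxy.symm⟩, hx.2⟩⟩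
  -- The stable sets through `v` number `∏ (m i - d i + 1)` over `i ≠ j`, where `m i` is the order of
  -- clique `i` and `d i ≥ 1` the number of neighbours of `v` in it. This is at most the product of
  -- the `m i` with `i ≠ j`, which is at most `centerCount`. As equality holds, `m j` is a smallest
  -- order and all `d i` with `i ≠ j` are `1`.
  have hmain : colorCard (S.erase v) κ j = #(S.erase v) / (b + 1) ∧
      ∀ i, i ≠ j → colorCard (G.nbr S v) κ i = 1 := by
    rcases lt_or_ge (#S) 2 with hS | hS
    · -- A single vertex.
      have := hs.le_card
      obtain rfl : b = 0 := by omega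
      refine ⟨?_, fun i hi => absurd (Fin.ext (by omega)) hi⟩
      have h3 : #(S.erase v) = 0 := by omega
      have h4 := single_le_sum (f := fun i => colorCard (S.erase v) κ i)
        (fun _ _ => Nat.zero_le _) (mem_univ j)
      rw [h3] at hsum ⊢
      simp only [hsum] at h4
      simpa using h4
    · have h3 := hc.lt_card hs hS
      have hq : 0 < #(S.erase v) / (b + 1) := Nat.div_pos (by omega) (by omega)
      obtain ⟨h4, h5⟩ := prod_erase_eq_centerCount hcol hsum j
      rw [hκ.numStable_nonNbr hj] at hn
      have hle : ∀ i, colorCard (G.nonNbr S v) κ i + 1 ≤ colorCard (S.erase v) κ i := by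
        intro i
        have h6 := hnbr i (by rcases hcol i with e | e <;> omega)
        have h7 := colorCard_nonNbr_add (G := G) (S := S) (v := v) κ i
        omega
      have hj' : colorCard (S.erase v) κ j = #(S.erase v) / (b + 1) := by
        refine (hcol j).resolve_right fun e => ?_
        have h6 := prod_le_prod' (s := univ.erase j) fun i _ => hle i
        have h7 := h5 e hq
        omega
      refine ⟨hj', fun i hi => ?_⟩
      by_contra hne
      have h7 := colorCard_nonNbr_add (G := G) (S := S) (v := v) κ i
      have h6 : ∏ i ∈ univ.erase j, (colorCard (G.nonNbr S v) κ i + 1) <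
          ∏ i ∈ univ.erase j, colorCard (S.erase v) κ i :=
        prod_lt_prod (fun _ _ => by omega) (fun i _ => hle i)
          ⟨i, mem_erase.2 ⟨hi, mem_univ _⟩, by
            have h6 := hnbr i (by rcases hcol i with e | e <;> omega)
            omega⟩
      rw [h4 hj'] at h6
      omega
  have hne : ∀ x, x ≠ v → Function.update κ v j x = κ x := fun x hx => Function.update_of_ne hx _ _
  have hcard : ∀ i, colorCard (S.erase v) (Function.update κ v j) i =
      colorCard (S.erase v) κ i := by
    intro i
    unfold colorCard
    congr 1
    ext x
    rw [mem_colorClass, mem_colorClass, and_congr_right_iff]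
    intro hx
    rw [hne x (mem_erase.1 hx).1]
  refine ⟨Function.update κ v j, hv, ?_, ?_, ?_, ?_, ?_⟩
  · intro x hx y hy hxy
    rw [hne x (mem_erase.1 hx).1, hne y (mem_erase.1 hy).1]
    exact hκ x hx y hy hxy
  · intro x hx e
    rw [hne x (mem_erase.1 hx).1, Function.update_self] at e
    exact hj x hx e
  · intro i hi
    rw [Function.update_self] at hi
    refine Eq.trans ?_ (hmain.2 i hi)
    unfold colorCard
    congr 1
    ext x
    rw [mem_colorClass, mem_colorClass, and_congr_right_iff]
    intro hx
    rw [hne x (mem_nbr.1 hx).2.ne']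
  · rw [Function.update_self, hcard, hmain.1]
  · intro i
    rw [hcard]
    exact hcol i

/-! ### The cycle of length five -/

/-- `S` induces a cycle of length five. -/
def IsCycleFive (G : SimpleGraph V) (S : Finset V) : Prop :=
  ∃ f : Fin 5 → V, Function.Injective f ∧ univ.image f = S ∧
    ∀ i j, G.Adj (f i) (f j) ↔ (cycleGraph 5).Adj i j

theorem isCycleFive_of_adj {p q r s t : V} (hS : S = {p, q, r, s, t}) (hcard : #S = 5)
    (hpq : G.Adj p q) (hqr : G.Adj q r) (hrs : G.Adj r s) (hst : G.Adj s t) (htp : G.Adj t p)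
    (hpr : ¬ G.Adj p r) (hps : ¬ G.Adj p s) (hqs : ¬ G.Adj q s) (hqt : ¬ G.Adj q t)
    (hrt : ¬ G.Adj r t) : G.IsCycleFive S := by
  have himage : univ.image ![p, q, r, s, t] = S := by
    rw [hS]; ext x; simp [Fin.exists_fin_succ, eq_comm]
  refine ⟨![p, q, r, s, t], ?_, himage, ?_⟩
  · rw [← Set.injOn_univ, ← coe_univ, ← card_image_iff, himage, hcard]; rfl
  · intro i j
    have hadj : (cycleGraph 5).Adj i j ↔ i - j = 1 ∨ j - i = 1 := by
      rw [cycleGraph_adj]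
    rw [hadj]
    have h1 := hpq.symm
    have h2 := hqr.symm
    have h3 := hrs.symm
    have h4 := hst.symm
    have h5 := htp.symm
    have h6 : ¬ G.Adj r p := fun h => hpr h.symm
    have h7 : ¬ G.Adj s p := fun h => hps h.symm
    have h8 : ¬ G.Adj s q := fun h => hqs h.symm
    have h9 : ¬ G.Adj t q := fun h => hqt h.symm
    have h10 : ¬ G.Adj t r := fun h => hrt h.symm
    have h0 : ∀ z, ¬ G.Adj z z := fun z => G.loopless.irrefl z
    fin_cases i <;> fin_cases j <;>
      first
        | exact iff_of_false (h0 _) (by decide)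
        | exact iff_of_true (by assumption) (by decide)
        | exact iff_of_false (by assumption) (by decide)

theorem IsCycleFive.card (h : G.IsCycleFive S) : #S = 5 := by
  obtain ⟨f, hf, rfl, -⟩ := h
  rw [card_image_of_injective _ hf, card_univ, Fintype.card_fin]

/-- The only graph without cut vertices that attains the bound and has stability number at least
two: if `v` has degree `(#S - 1) / a`, if `S \ {v}` is Turán-connected with equal cliques, and if
the non-neighbours of `v` form a Turán graph, then `a = 2` and `S` induces a five-cycle. -/
theorem isCycleFive_of_isTuranConn_erase {b q : ℕ} {x : V} {κ : V → Fin (b + 2)} (hv : v ∈ S)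
    (hs : G.StableLE S (b + 2)) (hκ : G.IsTuranConn (S.erase v) x κ)
    (hcard : #S = q * (b + 2) + 1) (hdeg : ∀ w ∈ S, #(G.nbr S w) ≤ q) (hv' : #(G.nbr S v) = q)
    (hn : G.numStable (G.nonNbr S v) = turanCount (#(G.nonNbr S v)) (b + 1)) :
    b = 0 ∧ G.IsCycleFive S := by
  have hxS : x ∈ S := mem_of_mem_erase hκ.mem
  have hxv : x ≠ v := (mem_erase.1 hκ.mem).1
  have hc1 := card_erase_add_one hv
  have hc2 := card_erase_add_one hκ.mem
  have hq0 : 0 < q := by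
    rcases Nat.eq_zero_or_pos q with rfl | h
    · have : 0 < #(S.erase v) := card_pos.2 ⟨x, hκ.mem⟩
      omega
    · exact h
  have hdiv : #((S.erase v).erase x) / (b + 2) = q - 1 := by
    obtain ⟨p, rfl⟩ : ∃ p, q = p + 1 := ⟨q - 1, by omega⟩
    have : #((S.erase v).erase x) = (b + 2) * p + (b + 1) := by
      have e : (p + 1) * (b + 2) = (b + 2) * p + (b + 2) := by ring
      omega
    rw [this, Nat.mul_add_div (by omega), Nat.div_eq_of_lt (by omega)]
    omega
  have hdx := hκ.card_nbr
  rw [hdiv] at hdx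
  have hsub : ∀ w, G.nbr (S.erase v) w ⊆ G.nbr S w := fun w z hz =>
    mem_nbr.2 ⟨mem_of_mem_erase (mem_nbr.1 hz).1, (mem_nbr.1 hz).2⟩
  -- The centre `x` has degree `q - 1 + (b + 1)` in `S \ {v}`, and at most `q` in `S`.
  have hb : b = 0 := by
    have h1 := card_le_card (hsub x)
    have h2 := hdeg x hxS
    omega
  subst hb
  refine ⟨rfl, ?_⟩
  obtain ⟨i, hi⟩ := exists_ne (κ x)
  have hcol : ∀ z, κ z = κ x ∨ κ z = i := fun z => by
    have h1 := (κ z).isLt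
    have h2 := (κ x).isLt
    have h3 := i.isLt
    rw [Ne, Fin.ext_iff] at hi
    rw [Fin.ext_iff, Fin.ext_iff]
    omega
  obtain ⟨y, hy⟩ := card_eq_one.1 (hκ.card_nbr_color i hi)
  have hy' : ∀ z, z = y ↔ (z ∈ S.erase v ∧ G.Adj x z) ∧ κ z = i := fun z => by
    rw [← mem_nbr, ← mem_colorClass, hy, mem_singleton]
  obtain ⟨⟨hyT, hxy⟩, hyi⟩ := (hy' y).1 rfl
  have hyS := mem_of_mem_erase hyT
  have hyU : y ∈ (S.erase v).erase x := mem_erase.2 ⟨hxy.ne', hyT⟩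
  have hci : colorCard ((S.erase v).erase x) κ i = q := by
    have h1 := sum_colorCard ((S.erase v).erase x) κ
    rw [← add_sum_erase univ _ (mem_univ (κ x)), hκ.card_center, hdiv] at h1
    have h2 : univ.erase (κ x) = {i} := by
      ext j
      have h1 := j.isLt
      have h2 := (κ x).isLt
      have h3 := i.isLt
      rw [Ne, Fin.ext_iff] at hi
      rw [mem_erase, mem_singleton, Ne, Fin.ext_iff, Fin.ext_iff]
      simp only [mem_univ, and_true]
      omega
    rw [h2, sum_singleton] at h1
    omega
  -- Both ends of the edge `xy` have degree `q` already in `S \ {v}`.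
  have hvx : ¬ G.Adj v x := fun hvx => by
    have h1 : insert v (G.nbr (S.erase v) x) ⊆ G.nbr S x :=
      insert_subset (mem_nbr.2 ⟨hv, hvx.symm⟩) (hsub x)
    have h2 := card_le_card h1
    rw [card_insert_of_notMem (by simp [mem_nbr]), hdx] at h2
    have h3 := hdeg x hxS
    omega
  have hvy : ¬ G.Adj v y := fun hvy => by
    have h1 : insert v (insert x ((colorClass ((S.erase v).erase x) κ i).erase y)) ⊆
        G.nbr S y := by
      refine insert_subset (mem_nbr.2 ⟨hv, hvy.symm⟩)
        (insert_subset (mem_nbr.2 ⟨hxS, hxy.symm⟩) fun z hz => ?_)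
      rw [mem_erase, mem_colorClass] at hz
      exact mem_nbr.2 ⟨mem_of_mem_erase (mem_of_mem_erase hz.2.1),
        (hκ.cliques y hyU z hz.2.1 hz.1.symm).2 (hyi.trans hz.2.2.symm)⟩
    have h2 := card_le_card h1
    rw [card_insert_of_notMem (by simp [mem_colorClass, hxv.symm]),
      card_insert_of_notMem (by simp [mem_colorClass]),
      card_erase_add_one (mem_colorClass.2 ⟨hyU, hyi⟩)] at h2
    have h3 := hdeg y hyS
    unfold colorCard at hci
    omega
  -- The non-neighbours of `v` form a clique containing both `x` and `y`, hence consist of `x` and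
  -- `y` only.
  obtain ⟨κ', hκ', -⟩ := (hs.nonNbr hv).exists_isCliqueUnion hn
  have hxW : x ∈ G.nonNbr S v := mem_nonNbr.2 ⟨hxS, hxv, hvx⟩
  have hyW : y ∈ G.nonNbr S v := mem_nonNbr.2 ⟨hyS, (mem_erase.1 hyT).1, hvy⟩
  have hadjW : ∀ z ∈ G.nonNbr S v, ∀ w ∈ G.nonNbr S v, z ≠ w → G.Adj z w := fun z hz w hw hzw =>
    (hκ' z hz w hw hzw).2 (Fin.ext (by omega))
  have hW : G.nonNbr S v = {x, y} := by
    refine Subset.antisymm (fun z hz => ?_) (insert_subset hxW (singleton_subset_iff.2 hyW))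
    rw [mem_insert, mem_singleton]
    by_contra! hne
    have hzT : z ∈ S.erase v := nonNbr_subset_erase hz
    have hxz := hadjW x hxW z hz hne.1.symm
    rcases hcol z with h1 | h1
    · have h2 := (hκ.cliques z (mem_erase.2 ⟨hne.1, hzT⟩) y hyU hne.2).1 (hadjW z hz y hyW hne.2)
      exact hi (by rw [← hyi, ← h2, h1])
    · exact hne.2 ((hy' z).2 ⟨⟨hzT, hxz⟩, h1⟩)
  have hq : q = 2 := by
    have h1 := card_nonNbr_add (G := G) hv
    rw [hW, card_pair hxy.ne] at h1
    omega
  subst hq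
  obtain ⟨u, hu⟩ := card_eq_one.1 (show colorCard ((S.erase v).erase x) κ (κ x) = 1 by
    rw [hκ.card_center, hdiv])
  obtain ⟨w, hw⟩ := card_eq_one.1 (show #((colorClass ((S.erase v).erase x) κ i).erase y) = 1 by
    rw [card_erase_of_mem (mem_colorClass.2 ⟨hyU, hyi⟩)]
    unfold colorCard at hci
    omega)
  have hu' : ∀ z, z = u ↔ z ∈ (S.erase v).erase x ∧ κ z = κ x := fun z => by
    rw [← mem_colorClass, hu, mem_singleton]
  have hw' : ∀ z, z = w ↔ z ≠ y ∧ z ∈ (S.erase v).erase x ∧ κ z = i := fun z => by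
    rw [← mem_colorClass, ← mem_erase, hw, mem_singleton]
  obtain ⟨huU, hux⟩ := (hu' u).1 rfl
  obtain ⟨hwy, hwU, hwi⟩ := (hw' w).1 rfl
  have huw : κ u ≠ κ w := by rw [hux, hwi]; exact hi.symm
  have huy : κ u ≠ κ y := by rw [hux, hyi]; exact hi.symm
  have huT := mem_of_mem_erase huU
  have hwT := mem_of_mem_erase hwU
  have hvadj : ∀ z ∈ (S.erase v).erase x, z ≠ y → G.Adj v z := by
    intro z hz hzy
    by_contra hvz
    have h1 : z ∈ G.nonNbr S v := mem_nonNbr.2 ⟨mem_of_mem_erase (mem_of_mem_erase hz),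
      (mem_erase.1 (mem_of_mem_erase hz)).1, hvz⟩
    rw [hW, mem_insert, mem_singleton] at h1
    exact h1.elim (mem_erase.1 hz).1 hzy
  refine isCycleFive_of_adj (p := v) (q := u) (r := x) (s := y) (t := w) ?_ (by omega)
    (hvadj u huU fun e => huy (congrArg κ e)) (hκ.adj_of_color u huU hux).symm hxy
    ((hκ.cliques y hyU w hwU hwy.symm).2 (hyi.trans hwi.symm)) (hvadj w hwU hwy).symm hvx hvy
    (fun h => huy ((hκ.cliques u huU y hyU h.ne).1 h))
    (fun h => huw ((hκ.cliques u huU w hwU h.ne).1 h))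
    (fun h => hwy ((hy' w).2 ⟨⟨hwT, h⟩, hwi⟩))
  ext z
  simp only [mem_insert, mem_singleton]
  constructor
  · intro hz
    by_cases hzv : z = v
    · exact Or.inl hzv
    by_cases hzx : z = x
    · exact Or.inr (Or.inr (Or.inl hzx))
    have hzU : z ∈ (S.erase v).erase x := mem_erase.2 ⟨hzx, mem_erase.2 ⟨hzv, hz⟩⟩
    rcases hcol z with h1 | h1
    · exact Or.inr (Or.inl ((hu' z).2 ⟨hzU, h1⟩))
    · by_cases hzy : z = y
      · exact Or.inr (Or.inr (Or.inr (Or.inl hzy)))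
      · exact Or.inr (Or.inr (Or.inr (Or.inr ((hw' z).2 ⟨hzy, hzU, h1⟩))))
  · rintro (rfl | rfl | rfl | rfl | rfl)
    · exact hv
    · exact mem_of_mem_erase huT
    · exact hxS
    · exact hyS
    · exact mem_of_mem_erase hwT

/-! ### The bound for connected graphs -/

/-- The bound for connected graphs together with a description of the case of equality that can be
carried through an induction. -/
def TuranConnBound (G : SimpleGraph V) (S : Finset V) (a : ℕ) : Prop :=
  G.numStable S ≤ turanConnCount (#S) a ∧
    (G.numStable S = turanConnCount (#S) a →
      (∃ v ∈ S, G.numStable (S.erase v) = turanCount (#S - 1) a) ∨ a = 2 ∧ G.IsCycleFive S)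

/-- The bound for a graph with a bridge `xy` across which the stability number is additive. In the
case of equality, the vertex whose deletion leaves a Turán graph is `x` or `y`. -/
theorem TuranConnBound.of_bridge {A B : Finset V} {x y : V} {b c : ℕ}
    (hb : G.HasStability A (b + 1)) (hc : G.HasStability B (c + 1)) (hd : Disjoint A B)
    (hx : x ∈ A) (hy : y ∈ B) (hxy : G.Adj x y)
    (h : ∀ u ∈ A, ∀ w ∈ B, G.Adj u w → u = x ∧ w = y) (hlt : b + c + 2 < #(A ∪ B))
    (hA : G.numStable A ≤ turanConnCount (#A) (b + 1))
    (hB : G.numStable B ≤ turanConnCount (#B) (c + 1)) :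
    G.TuranConnBound (A ∪ B) (b + c + 2) := by
  have hxB : x ∉ B := Finset.disjoint_left.1 hd hx
  have hyA : y ∉ A := Finset.disjoint_right.1 hd hy
  rw [card_union_of_disjoint hd] at hlt
  have c1 := card_erase_add_one hx
  have c2 := card_erase_add_one hy
  have l1 := hb.le_card
  have l2 := hc.le_card
  have g1 := (hb.1.mono (erase_subset x A)).numStable_le
  have g2 := (hc.1.mono (erase_subset y B)).numStable_le
  have e2 : turanConnCount (#(B.erase y) + 1) (c + 1) =
    turanCount (#(B.erase y)) (c + 1) + centerCount (#(B.erase y)) (c + 1) := rfl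
  have e3 : turanConnCount (#(A.erase x) + 1) (b + 1) =
    turanCount (#(A.erase x)) (b + 1) + centerCount (#(A.erase x)) (b + 1) := rfl
  rw [← c1, numStable_eq hx, e3] at hA
  rw [← c2, numStable_eq hy, e2] at hB
  obtain ⟨h1, h2⟩ := bridge_count_le numStable_pos numStable_pos (turanCount_pos _ _)
    (centerCount_pos (by omega)) g1 hA g2 hB
  obtain ⟨h3, h4⟩ := turanConnCount_join_le (n₁ := #(A.erase x)) (n₂ := #(B.erase y)) (a := b)
    (b := c) (by omega) (by omega) (by omega)
  have e0 : #(A ∪ B) = #(A.erase x) + #(B.erase y) + 2 := by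
    rw [card_union_of_disjoint hd]; omega
  have e1 : G.numStable (A ∪ B) = G.numStable (A.erase x) *
      (G.numStable (B.erase y) + G.numStable (G.nonNbr B y)) +
      G.numStable (G.nonNbr A x) * G.numStable (B.erase y) := by
    rw [numStable_of_bridge hd hx hxy h, numStable_eq hy]
  have e4 : #(A.erase x) + #(B.erase y) + 2 - 1 = #(A.erase x) + #(B.erase y) + 1 := by omega
  unfold TuranConnBound
  rw [e0, e1, e4]
  rw [e2] at h3 h4
  rw [e3] at h4
  refine ⟨h1.trans h3, fun he => Or.inl ?_⟩
  obtain ⟨f1, f2, f3, f4⟩ := h2 (le_antisymm h1 (he ▸ h3))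
  rcases h4 (le_antisymm h3 (he ▸ h1)) with h5 | h5
  · refine ⟨x, mem_union_left _ hx, ?_⟩
    rw [erase_union_distrib, erase_eq_of_notMem hxB, numStable_union
      (hd.mono_left (erase_subset _ _)) (fun u hu w hw huw =>
        (mem_erase.1 hu).1 (h u (mem_of_mem_erase hu) w hw huw).1), numStable_eq hy, ← h5, f1, f4]
  · refine ⟨y, mem_union_right _ hy, ?_⟩
    rw [erase_union_distrib, erase_eq_of_notMem hyA, numStable_union
      (hd.mono_right (erase_subset _ _)) (fun u hu w hw huw =>
        (mem_erase.1 hw).1 (h u hu w (mem_of_mem_erase hw) huw).2), numStable_eq hx, ← h5, f2, f3,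
      mul_comm]

theorem TuranConnBound.of_card_eq_one (hS : #S = 1) (hs : G.HasStability S a) :
    G.TuranConnBound S a := by
  obtain ⟨v, rfl⟩ := card_eq_one.1 hS
  obtain ⟨b, rfl⟩ := hs.exists_succ (singleton_nonempty v)
  have h1 := hs.le_card
  rw [hS] at h1
  obtain rfl : b = 0 := by omega
  have h2 : G.nonNbr {v} v = ∅ := by
    rw [eq_empty_iff_forall_notMem]
    intro x hx
    rw [mem_nonNbr, mem_singleton] at hx
    exact hx.2.1 hx.1
  refine ⟨?_, fun _ => Or.inl ⟨v, mem_singleton_self v, ?_⟩⟩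
  · rw [numStable_eq (mem_singleton_self v), h2, erase_singleton, numStable_empty, hS]
    decide
  · rw [erase_singleton, numStable_empty, hS]
    decide

/-- The bound for a graph all of whose edges are critical: delete a vertex of maximum degree. -/
theorem TuranConnBound.of_critical (hc : G.ConnectedOn S) (hs : G.HasStability S a)
    (hS : 2 ≤ #S)
    (hcrit : ∀ x ∈ S, ∀ y ∈ S, G.Adj x y → ¬ (G.deleteEdges {s(x, y)}).StableLE S a)
    (ih : ∀ v ∈ S, G.ConnectedOn (S.erase v) → G.HasStability (S.erase v) a →
      G.TuranConnBound (S.erase v) a) : G.TuranConnBound S a := by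
  have hne : S.Nonempty := card_pos.1 (by omega)
  obtain ⟨v, hv, hmax⟩ := exists_max_nbr G hne
  obtain ⟨b, rfl⟩ := hs.exists_succ hne
  have hlt := hc.lt_card hs hS
  have hc' := hc.erase hs.1 hv hcrit
  have c1 := card_erase_add_one hv
  have c2 := card_nonNbr_add (G := G) hv
  have hs' : G.HasStability (S.erase v) (b + 1) := by
    refine ⟨hs.1.mono (erase_subset _ _), ?_⟩
    obtain ⟨w, hw, hvw⟩ := hc.exists_adj hv hS
    obtain ⟨s, hsS, hvs, -, hcard, hi, -⟩ :=
      exists_of_not_stableLE_deleteEdges hs.1 (hcrit v hv w hw hvw)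
    obtain ⟨t, ht, htc⟩ := exists_subset_card_eq (s := s.erase v) (n := b + 1) (by
      have := card_erase_add_one hvs
      omega)
    exact ⟨t, ht.trans (erase_subset_erase _ hsS), isIndepSet_coe_mono ht hi, htc⟩
  obtain ⟨k, hk⟩ : ∃ k, #(S.erase v) = k + 1 := ⟨#(S.erase v) - 1, by omega⟩
  have hdeg := hc.card_le hne hs.1 hmax
  obtain ⟨i1, i2⟩ := ih v hv hc' hs'
  have j1 := (hs.1.nonNbr hv).numStable_le
  have hD : k / (b + 1) + 1 ≤ #(G.nbr S v) := by
    rw [Nat.succ_le_iff, Nat.div_lt_iff_lt_mul (by omega), mul_comm]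
    omega
  have hn : #(G.nonNbr S v) = k + 1 - #(G.nbr S v) := by omega
  obtain ⟨h1, h2⟩ := turanConnCount_add_le (b := b) (by omega) hD (by omega)
  have hSk : #S = k + 2 := by omega
  unfold TuranConnBound
  rw [hk] at i1 i2
  rw [numStable_eq hv, hSk]
  rw [hn] at j1
  refine ⟨by omega, fun he => ?_⟩
  obtain ⟨⟨q, hq⟩, hDq⟩ := h2 (by omega)
  -- Equality forces `b + 1` to divide `#S - 1`, and `v` to have degree `(#S - 1) / (b + 1)`.
  rcases b with _ | b
  · refine Or.inl ⟨v, hv, ?_⟩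
    have : G.numStable (S.erase v) = turanConnCount (k + 1) 1 := by
      simp only [zero_add] at *
      omega
    rw [this, turanConnCount_one]
    rfl
  · obtain ⟨p, rfl⟩ : ∃ p, q = p + 1 := ⟨q - 1, by
      have : q ≠ 0 := by rintro rfl; omega
      omega⟩
    have hkp : k = (b + 2) * p + (b + 1) := by
      have : (b + 1 + 1) * (p + 1) = (b + 2) * p + (b + 2) := by ring
      omega
    have hdiv : k / (b + 1 + 1) = p := by
      rw [hkp, Nat.mul_add_div (by omega), Nat.div_eq_of_lt (by omega), add_zero]
    rcases i2 (by omega) with ⟨x, hx, hxT⟩ | ⟨hb, hC⟩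
    · obtain ⟨κ, hκ⟩ := hc'.exists_isTuranConn hs' hx (by rw [hk]; exact hxT) (by rw [hk]; omega)
      obtain ⟨rfl, hC⟩ := isCycleFive_of_isTuranConn_erase (q := p + 1) hv hs.1 hκ
        (by rw [hSk, show k + 2 = k + 1 + 1 from rfl, hq]; ring)
        (fun w hw => (hmax w hw).trans (by omega)) (by omega) (by rw [hn]; omega)
      exact Or.inr ⟨rfl, hC⟩
    · -- The order `5` of a five-cycle is not divisible by its stability number.
      have h5 := hC.card
      obtain rfl : b = 0 := by omega
      omega

theorem ConnectedOn.turanConnBound [Finite V] (hc : G.ConnectedOn S) (hS : S.Nonempty)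
    (hs : G.HasStability S a) : G.TuranConnBound S a := by
  induction S using Finset.strongInduction generalizing G a with
  | H S ihS =>
    induction G using WellFoundedLT.induction with
    | ind G ihG =>
      rcases lt_or_ge (#S) 2 with h2 | h2
      · exact TuranConnBound.of_card_eq_one (by have := card_pos.2 hS; omega) hs
      by_cases hcrit : ∀ x ∈ S, ∀ y ∈ S, G.Adj x y → ¬ (G.deleteEdges {s(x, y)}).StableLE S a
      · refine TuranConnBound.of_critical hc hs h2 hcrit fun v hv hc' hs' =>
          ihS _ (erase_ssubset hv) hc' ?_ hs'
        exact card_pos.1 (by have := card_erase_add_one hv; omega)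
      push Not at hcrit
      obtain ⟨x, hx, y, hy, hxy, hsafe⟩ := hcrit
      by_cases hc' : (G.deleteEdges {s(x, y)}).ConnectedOn S
      · -- A noncritical edge that is not a bridge can be deleted.
        have hlt : G.deleteEdges {s(x, y)} < G := by
          refine lt_of_le_of_ne (deleteEdges_le _) fun e => ?_
          rw [← e, deleteEdges_adj] at hxy
          exact hxy.2 rfl
        obtain ⟨s, hsS, hi, hcard⟩ := hs.2
        have h1 := (ihG _ hlt hc' ⟨hsafe, s, hsS, isIndepSet_coe.2 fun u hu w hw h =>
          isIndepSet_coe.1 hi u hu w hw (hlt.le h), hcard⟩).1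
        have h3 := numStable_lt_deleteEdges hx hy hxy
        exact ⟨h3.le.trans h1, fun he => by omega⟩
      · obtain ⟨A, B, rfl, hd, hxA, hyB, hAB⟩ := hc.exists_partition hc'
        obtain ⟨b, hb⟩ := exists_hasStability G A
        obtain ⟨c, hcB⟩ := exists_hasStability G B
        obtain ⟨b, rfl⟩ := hb.exists_succ ⟨x, hxA⟩
        obtain ⟨c, rfl⟩ := hcB.exists_succ ⟨y, hyB⟩
        have hA : G.ConnectedOn A := hc.of_bridge rfl hd ⟨y, hyB⟩ hAB
        have hB : G.ConnectedOn B := hc.of_bridge (x := y) (y := x) (union_comm _ _) hd.symm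
          ⟨x, hxA⟩ fun u hu w hw h => (hAB w hw u hu h.symm).symm
        obtain rfl : b + c + 2 = a := by
          have := hs.add_eq hb hcB hd hAB hsafe
          omega
        have hyA : y ∉ A := Finset.disjoint_right.1 hd hyB
        have hxB : x ∉ B := Finset.disjoint_left.1 hd hxA
        exact TuranConnBound.of_bridge hb hcB hd hxA hyB hxy hAB (hc.lt_card hs h2)
          (ihS A ⟨subset_union_left, fun h => hyA (h hy)⟩ hA ⟨x, hxA⟩ hb).1
          (ihS B ⟨subset_union_right, fun h => hxB (h hx)⟩ hB ⟨y, hyB⟩ hcB).1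

end

section
open scoped Classical

/-! ### Uniqueness of the Turán-connected graph -/

/-- The colour of a vertex `x`, together with whether `x` is equal to `v` and whether it is adjacent
to `v`. These data determine the adjacencies in a Turán-connected graph with centre `v`. -/
noncomputable def vertexType {V ι : Type*} (G : SimpleGraph V) (v : V) (κ : V → ι) (x : V) :
    ι × Bool × Bool :=
  (κ x, decide (x = v), decide (G.Adj v x))

/-- The number of vertices of each type is determined by the orders of the cliques. -/
theorem IsTuranConn.card_vertexType {V : Type*} [Fintype V] {G : SimpleGraph V} {v : V} {a : ℕ}
    {κ : V → Fin a} (h : G.IsTuranConn univ v κ) (i : Fin a) (p q : Bool) :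
    Fintype.card {x // G.vertexType v κ x = (i, p, q)} =
      if p then (if i = κ v ∧ q = false then 1 else 0)
      else if q then (if i = κ v then colorCard (univ.erase v) κ i else 1)
      else (if i = κ v then 0 else colorCard (univ.erase v) κ i - 1) := by
  have h1 : ∀ i, i = κ v → colorCard (G.nonNbr univ v) κ i = 0 := by
    rintro i rfl
    exact colorCard_nonNbr_eq_zero h.adj_of_color
  have h2 := colorCard_nonNbr_add (G := G) (S := univ) (v := v) κ i
  rw [Fintype.card_subtype]
  cases p
  · cases q
    · have e : ({x | G.vertexType v κ x = (i, false, false)} : Finset V) =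
          colorClass (G.nonNbr univ v) κ i := by
        ext x
        simp [vertexType, mem_colorClass, mem_nonNbr]
        tauto
      rw [e]
      change colorCard (G.nonNbr univ v) κ i = _
      by_cases hi : i = κ v
      · simp [hi, h1]
      · have := h.card_nbr_color i hi
        simp only [hi]
        simp; omega
    · have e : ({x | G.vertexType v κ x = (i, false, true)} : Finset V) =
          colorClass (G.nbr univ v) κ i := by
        ext x
        have : G.Adj v x → x ≠ v := fun h => h.ne'
        simp [vertexType, mem_colorClass, mem_nbr]
        tauto
      rw [e]
      change colorCard (G.nbr univ v) κ i = _
      by_cases hi : i = κ v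
      · have := h1 i hi
        simp only [hi] at *
        simp; omega
      · simp [hi, h.card_nbr_color i hi]
  · by_cases hi : i = κ v ∧ q = false
    · obtain ⟨rfl, rfl⟩ := hi
      simp only [and_self, if_true]
      rw [card_eq_one]
      refine ⟨v, ?_⟩
      ext x
      simp only [vertexType, mem_filter, mem_univ, true_and, Prod.mk.injEq, decide_eq_true_eq,
        decide_eq_false_iff_not, mem_singleton]
      constructor
      · exact fun h => h.2.1
      · rintro rfl; simp
    · simp only [hi, if_true, if_false]
      rw [card_eq_zero, filter_eq_empty_iff]
      intro x _ hx
      simp only [vertexType, Prod.mk.injEq, decide_eq_true_eq] at hx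
      obtain ⟨rfl, rfl, rfl⟩ := hx
      simp at hi

/-- Turán-connected graphs of the same order and with the same number of cliques are isomorphic. -/
theorem IsTuranConn.nonempty_iso {V W : Type*} [Fintype V] [Fintype W] {G : SimpleGraph V}
    {H : SimpleGraph W} {v : V} {w : W} {a : ℕ} {κ : V → Fin a} {μ : W → Fin a}
    (hG : G.IsTuranConn univ v κ) (hH : H.IsTuranConn univ w μ)
    (h : Fintype.card V = Fintype.card W) : Nonempty (G ≃g H) := by
  have c1 : #(univ.erase v) = #(univ.erase w) := by
    rw [card_erase_of_mem (mem_univ _), card_erase_of_mem (mem_univ _), card_univ, card_univ, h]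
  obtain ⟨σ, hσv, hσ⟩ := exists_perm_of_two_values hG.card_color
    (by rw [c1]; exact hH.card_color) (by rw [sum_colorCard, sum_colorCard, c1]) hG.card_center
    (by rw [c1]; exact hH.card_center)
  -- Vertices of the same type up to the permutation `σ` of the colours are matched arbitrarily.
  have hcard : ∀ c : Fin a × Bool × Bool,
      Fintype.card {x // G.vertexType v κ x = c} =
      Fintype.card {y // ((σ.symm (H.vertexType w μ y).1, (H.vertexType w μ y).2) :
        Fin a × Bool × Bool) = c} := by
    rintro ⟨i, p, q⟩
    have e : ∀ y, ((σ.symm (H.vertexType w μ y).1, (H.vertexType w μ y).2) :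
        Fin a × Bool × Bool) = (i, p, q) ↔ H.vertexType w μ y = (σ i, p, q) := by
      intro y
      rw [Prod.ext_iff, Prod.ext_iff (x := H.vertexType w μ y)]
      simp only [Equiv.symm_apply_eq]
    rw [Fintype.card_congr (Equiv.subtypeEquivRight e), hG.card_vertexType, hH.card_vertexType,
      hσ, ← hσv]
    simp only [σ.injective.eq_iff]
  let e := Equiv.ofFiberEquiv fun c => Fintype.equivOfCardEq (hcard c)
  have he : ∀ x, σ.symm (μ (e x)) = κ x ∧ (e x = w ↔ x = v) ∧ (H.Adj w (e x) ↔ G.Adj v x) := by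
    intro x
    have h1 : ((σ.symm (H.vertexType w μ (e x)).1, (H.vertexType w μ (e x)).2) :
        Fin a × Bool × Bool) = G.vertexType v κ x :=
      Equiv.ofFiberEquiv_map (fun c => Fintype.equivOfCardEq (hcard c)) x
    simpa [vertexType, Prod.ext_iff, decide_eq_decide] using h1
  refine ⟨⟨e, fun {x y} => ?_⟩⟩
  by_cases hx : x = v
  · subst hx
    rw [(he x).2.1.2 rfl]
    exact (he y).2.2
  by_cases hy : y = v
  · subst hy
    rw [(he y).2.1.2 rfl, G.adj_comm, H.adj_comm]
    exact (he x).2.2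
  by_cases hxy : x = y
  · subst hxy
    simp
  have hx' : e x ≠ w := fun e' => hx ((he x).2.1.1 e')
  have hy' : e y ≠ w := fun e' => hy ((he y).2.1.1 e')
  rw [hG.cliques x (by simpa using hx) y (by simpa using hy) hxy,
    hH.cliques (e x) (by simpa using hx') (e y) (by simpa using hy') (e.injective.ne hxy),
    ← (he x).1, ← (he y).1, σ.symm.injective.eq_iff]

theorem turanConnectedGraph_adj {n a : ℕ} {i j : Fin n} :
    (turanConnectedGraph n a).Adj i j ↔ i ≠ j ∧ ((i : ℕ) % a = j % a ∨
      ((i : ℕ) = 0 ∧ 1 ≤ (j : ℕ) ∧ (j : ℕ) < a) ∨ (j : ℕ) = 0 ∧ 1 ≤ (i : ℕ) ∧ (i : ℕ) < a) := by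
  simp only [turanConnectedGraph, cliqueTuranGraph, sup_adj, compl_adj, turanGraph_adj,
    fromRel_adj, not_not]
  tauto

/-- The conditions of `IsTuranConn`, with `S \ {v}` given as any set `T` with the right elements. -/
theorem IsTuranConn.of_erase_eq {V : Type*} {G : SimpleGraph V} {S T : Finset V} {v : V} {a : ℕ}
    {κ : V → Fin a} (hT : ∀ x, x ∈ T ↔ x ≠ v ∧ x ∈ S) (hv : v ∈ S) (h : G.IsCliqueUnion T κ)
    (hadj : ∀ x ∈ T, κ x = κ v → G.Adj v x) (hnbr : ∀ i, i ≠ κ v → colorCard (G.nbr S v) κ i = 1)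
    (hcard : ∀ i, colorCard T κ i = #T / a ∨ i ≠ κ v ∧ colorCard T κ i = #T / a + 1) :
    G.IsTuranConn S v κ := by
  obtain rfl : T = S.erase v := by
    ext x
    rw [hT, mem_erase]
  exact ⟨hv, h, hadj, hnbr, (hcard (κ v)).resolve_right fun h => h.1 rfl,
    fun i => (hcard i).imp_right And.right⟩

/-- The residue classes make `T_c(n, a)` a Turán-connected graph in the structural sense. -/
theorem isTuranConn_turanConnectedGraph {m b : ℕ} (h : b ≤ m) :
    (turanConnectedGraph (m + 1) (b + 1)).IsTuranConn univ 0
      (fun i => (⟨i % (b + 1), Nat.mod_lt _ (by omega)⟩ : Fin (b + 1))) := by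
  set κ : Fin (m + 1) → Fin (b + 1) := fun i => ⟨i % (b + 1), Nat.mod_lt _ (by omega)⟩ with hκ
  have hcol : ∀ i j, κ i = κ j ↔ (i : ℕ) % (b + 1) = j % (b + 1) := fun i j => by
    simp [hκ, Fin.ext_iff]
  have hcard : #(univ.erase (0 : Fin (m + 1))) = m := by simp
  have hcount : ∀ i : Fin (b + 1), colorCard (univ.erase (0 : Fin (m + 1))) κ i =
      m / (b + 1) + if (i + b : ℕ) % (b + 1) < m % (b + 1) then 1 else 0 := by
    intro i
    -- The vertices `1, …, m` are shifted to `0, …, m - 1`, and `i` to `i + b`, which is `i - 1`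
    -- modulo `b + 1`.
    rw [← Nat.count_modEq_card m (by omega), Nat.count_eq_card_filter_range]
    have hmod : ∀ k : ℕ, k ≡ i + b [MOD b + 1] ↔ (k + 1) % (b + 1) = i := by
      intro k
      have h1 : (k + 1) % (b + 1) = i ↔ k + 1 ≡ i [MOD b + 1] := by
        rw [Nat.ModEq, Nat.mod_eq_of_lt i.isLt]
      have h2 : (i : ℕ) + b + 1 ≡ i [MOD b + 1] := by
        rw [Nat.ModEq, add_assoc, Nat.add_mod_right]
      rw [h1]
      exact ⟨fun h => (h.add_right 1).trans h2,
        fun h => Nat.ModEq.add_right_cancel' 1 (h.trans h2.symm)⟩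
    symm
    refine card_bij (fun k hk => (⟨k + 1, by
      have := mem_range.1 (mem_filter.1 hk).1
      omega⟩ : Fin (m + 1))) ?_ ?_ ?_
    · intro k hk
      rw [mem_filter, hmod] at hk
      rw [mem_colorClass, mem_erase]
      refine ⟨⟨by simp [Fin.ext_iff], mem_univ _⟩, ?_⟩
      simpa [hκ, Fin.ext_iff] using hk.2
    · intro k _ l _ e
      simpa using e
    · intro x hx
      rw [mem_colorClass, mem_erase, Ne, Fin.ext_iff] at hx
      simp only [hκ, Fin.ext_iff, Fin.val_zero] at hx
      have h0 := x.isLt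
      refine ⟨x - 1, ?_, ?_⟩
      · rw [mem_filter, hmod, mem_range, Nat.sub_add_cancel (by omega)]
        exact ⟨by omega, hx.2⟩
      · rw [Fin.ext_iff]
        simp only
        omega
  have hκ0 : ((κ 0 : Fin (b + 1)) : ℕ) = 0 := by simp [hκ]
  refine IsTuranConn.of_erase_eq (T := univ.erase 0) (fun x => mem_erase) (mem_univ _) ?_ ?_ ?_ ?_
  · intro x hx y hy hxy
    rw [mem_erase, Ne, Fin.ext_iff, Fin.val_zero] at hx hy
    rw [turanConnectedGraph_adj, hcol]
    tauto
  · intro x hx e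
    rw [hcol] at e
    rw [turanConnectedGraph_adj]
    exact ⟨(mem_erase.1 hx).1.symm, Or.inl e.symm⟩
  · intro i hi
    rw [Ne, Fin.ext_iff, hκ0] at hi
    have hib := i.isLt
    refine card_eq_one.2 ⟨⟨i, by omega⟩, ?_⟩
    ext x
    rw [mem_colorClass, mem_nbr, turanConnectedGraph_adj, mem_singleton]
    simp only [hκ, Fin.ext_iff, Fin.val_zero, mem_univ, true_and, Nat.zero_mod, Ne]
    constructor
    · rintro ⟨⟨h0, h1⟩, h2⟩
      rcases h1 with h1 | h1 | h1
      · omega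
      · rwa [Nat.mod_eq_of_lt h1.2] at h2
      · omega
    · intro e
      rw [e, Nat.mod_eq_of_lt hib]
      omega
  · intro i
    rw [hcount, hcard]
    split_ifs with hlt
    · refine Or.inr ⟨?_, rfl⟩
      rintro rfl
      rw [hκ0, zero_add, Nat.mod_eq_of_lt (by omega)] at hlt
      have := Nat.mod_lt m (show b + 1 > 0 by omega)
      omega
    · exact Or.inl rfl

/-! ### The whole vertex set -/

theorem fibonacciIndex_eq_numStable {V : Type*} [Fintype V] (G : SimpleGraph V) :
    fibonacciIndex G = G.numStable univ :=
  Nat.subtype_card _ fun s => by simp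

theorem Connected.connectedOn_univ {V : Type*} [Fintype V] {G : SimpleGraph V}
    (h : G.Connected) : G.ConnectedOn univ := by
  intro A _ ⟨x, hx⟩ hA
  obtain ⟨y, hy⟩ : ∃ y, y ∉ A := by
    by_contra! hall
    exact hA (eq_univ_iff_forall.2 hall)
  obtain ⟨p⟩ := h.preconnected x y
  obtain ⟨d, -, h1, h2⟩ := p.exists_boundary_dart (A : Set V)
    (by simpa using hx) (by simpa using hy)
  exact ⟨d.fst, by simpa using h1, d.snd, mem_univ _, by simpa using h2, d.adj⟩

theorem hasStability_univ {V : Type*} [Fintype V] (G : SimpleGraph V) :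
    G.HasStability univ G.indepNum := by
  refine ⟨fun s _ hs => hs.card_le_indepNum, ?_⟩
  obtain ⟨s, hs⟩ := G.exists_isNIndepSet_indepNum
  exact ⟨s, subset_univ _, hs.1, hs.2⟩

theorem IsCycleFive.nonempty_iso {V : Type*} [Fintype V] {G : SimpleGraph V}
    (h : G.IsCycleFive univ) : Nonempty (G ≃g cycleGraph 5) := by
  obtain ⟨f, hf, hfs, hadj⟩ := h
  have hsurj : Function.Surjective f := fun x => by
    have : x ∈ univ.image f := by rw [hfs]; exact mem_univ x
    simpa using this
  exact ⟨(⟨Equiv.ofBijective f ⟨hf, hsurj⟩, fun {i j} => hadj i j⟩ : cycleGraph 5 ≃g G).symm⟩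

theorem Iso.fibonacciIndex_eq {V W : Type*} {G : SimpleGraph V} {H : SimpleGraph W}
    (e : G ≃g H) : fibonacciIndex G = fibonacciIndex H := by
  refine Nat.card_congr (e.toEquiv.finsetCongr.subtypeEquiv fun s => ?_)
  rw [isIndepSet_coe, isIndepSet_coe]
  simp only [Equiv.finsetCongr_apply, mem_map_equiv]
  constructor
  · exact fun h x hx y hy hxy => h _ hx _ hy (e.symm.map_adj_iff.2 hxy)
  · refine fun h x hx y hy hxy => h (e x) ?_ (e y) ?_ (e.map_adj_iff.2 hxy)
    · rwa [← e.toEquiv.symm_apply_apply x] at hx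
    · rwa [← e.toEquiv.symm_apply_apply y] at hy

end

theorem fibonacciIndex_cycleGraph_five : fibonacciIndex (cycleGraph 5) = 11 := by
  have h : #{s : Finset (Fin 5) | ∀ x ∈ s, ∀ y ∈ s, ¬ (x - y = 1 ∨ y - x = 1)} = 11 := by decide
  rw [← h]
  refine Nat.subtype_card _ fun s => ?_
  rw [isIndepSet_coe, mem_filter]
  simp only [mem_univ, true_and, cycleGraph_adj]

theorem fTC_eq_turanConnCount {m b : ℕ} (h : b ≤ m) :
    fTC (m + 1) (b + 1) = turanConnCount (m + 1) (b + 1) := by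
  rw [fTC, fibonacciIndex_eq_numStable, (isTuranConn_turanConnectedGraph h).numStable_eq, card_univ,
    Fintype.card_fin]

end SimpleGraph

theorem mainTheorem2 {V : Type*} [Fintype V] (G : SimpleGraph V) (hG : G.Connected) (n α : ℕ)
    (hn : Fintype.card V = n) (hα : G.indepNum = α) :
    fibonacciIndex G ≤ fTC n α ∧
    ((n, α) ≠ (5, 2) →
      (fibonacciIndex G = fTC n α ↔ Nonempty (G ≃g turanConnectedGraph n α))) ∧
    ((n, α) = (5, 2) →
      (fibonacciIndex G = fTC n α ↔
        Nonempty (G ≃g turanConnectedGraph 5 2) ∨ Nonempty (G ≃g SimpleGraph.cycleGraph 5))) := by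
  have hc := hG.connectedOn_univ
  have hs := G.hasStability_univ
  rw [hα] at hs
  have hne : (univ : Finset V).Nonempty := by
    have := hG.nonempty
    exact univ_nonempty
  obtain ⟨b, rfl⟩ := hs.exists_succ hne
  have hle := hs.le_card
  have hpos := card_pos.2 hne
  rw [card_univ, hn] at hle hpos
  obtain ⟨m, rfl⟩ : ∃ m, n = m + 1 := ⟨n - 1, by omega⟩
  obtain ⟨h1, h2⟩ := hc.turanConnBound hne hs
  rw [card_univ, hn, ← SimpleGraph.fTC_eq_turanConnCount (by omega),
    ← SimpleGraph.fibonacciIndex_eq_numStable] at h1 h2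
  have hiso : Nonempty (G ≃g turanConnectedGraph (m + 1) (b + 1)) →
      fibonacciIndex G = fTC (m + 1) (b + 1) := fun ⟨e⟩ => e.fibonacciIndex_eq
  have hext : fibonacciIndex G = fTC (m + 1) (b + 1) →
      Nonempty (G ≃g turanConnectedGraph (m + 1) (b + 1)) ∨
        (m + 1, b + 1) = (5, 2) ∧ Nonempty (G ≃g SimpleGraph.cycleGraph 5) := by
    intro he
    rcases h2 he with ⟨v, hv, hT⟩ | ⟨hb, hC⟩
    · left
      obtain ⟨κ, hκ⟩ := hc.exists_isTuranConn hs hv (by rw [card_univ, hn]; exact hT)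
        (by rw [card_univ, hn, ← SimpleGraph.fTC_eq_turanConnCount (by omega),
          ← SimpleGraph.fibonacciIndex_eq_numStable, he])
      exact hκ.nonempty_iso (SimpleGraph.isTuranConn_turanConnectedGraph (by omega))
        (by rw [hn, Fintype.card_fin])
    · right
      have h5 := hC.card
      rw [card_univ, hn] at h5
      exact ⟨by rw [h5, hb], hC.nonempty_iso⟩
  refine ⟨h1, fun hne => ⟨fun he => ?_, hiso⟩, fun heq => ⟨fun he => ?_, ?_⟩⟩
  · exact (hext he).resolve_right fun h => hne h.1
  · obtain ⟨rfl, rfl⟩ : m = 4 ∧ b = 1 := by simpa using heq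
    exact (hext he).imp_right fun h => h.2
  · obtain ⟨rfl, rfl⟩ : m = 4 ∧ b = 1 := by simpa using heq
    rintro (h | ⟨⟨e⟩⟩)
    · exact hiso h
    · rw [e.fibonacciIndex_eq, SimpleGraph.fibonacciIndex_cycleGraph_five,
        SimpleGraph.fTC_eq_turanConnCount (by omega)]
      decide
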